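/- Let $V=\mathbb C^3$ with coordinates $x_0,x_1,x_2$, let $U=\mathsf S^3(V^*)$ be the space of ternary cubic forms, and let $PG=\mathrm{PSL}_3(\mathbb C)$ act on $\mathbb P(V)$ and on $\mathbb P(U)$ via $(g\cdot f)(v)=f(g^{-1}v)$. For a nonzero $f\in U$ put $C(f)=\{c\in\mathbb P(V)\mid f(c)=0\}$. Let $$L=\{\alpha(x_0^3+x_1^3+x_2^3)+\beta x_0x_1x_2\mid \alpha,\beta\in\mathbb C\},\qquad \ell=\mathbb P(L)\subset\mathbb P(U),\qquad \mathcal H=\{C(f)\mid 0\ne f\in L\}.$$ For a group $R$ acting on a set $A$ and $B\subseteq A$ put $N_{R,B}=\{r\in R\mid r\cdot B\subseteq B\}$. Let the Hessian group $\mathrm{Hes}$ be the subgroup $\{g\in PG\mid g\cdot\mathcal H=\mathcal H\}$ of $PG$. A Zariski closed subset $S$ of an irreducible variety $M$ with an action of an algebraic group $R$ is called a relative section if $\overline{R\cdot S_i}=M$ for every irreducible component $S_i$ of $S$, and there is a dense open subset $S^0$ of $S$ such that every $r\in R$ with $r\cdot S^0\cap S^0\neq\varnothing$ lies in $N_{R,S}$.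 Let $\varepsilon\in\mathbb C$ be a primitive cubic root of $1$, and for $j\in\{0,1,2\}$ put $t_{0,j}=(0:-\varepsilon^j:1)$, $t_{1,j}=(1:0:-\varepsilon^j)$, $t_{2,j}=(-\varepsilon^j:1:0)$, the indices being regarded as elements of $\mathbb F_3$. **Theorem.** 1. The line $\ell$ is a relative section for the action of $PG$ on $\mathbb P(U)$. 2. $N_{PG,\ell}=N_{PG,\mathcal H}=\mathrm{Hes}$. 3. The nine points $t_{i,j}$, $(i,j)\in\mathbb F_3^2$, are pairwise distinct, and for every $f\in L$ such that $C(f)$ is a smooth cubic they are exactly the flexes of $C(f)$, i.e. the points of $C(f)$ at which the Hessian determinant of $f$ vanishes. $\mathrm{Hes}$ permutes these nine points, and if the points are labelled by $t_{i,j}\mapsto(i,j)$, the resulting action on $\mathbb F_3^2$ is by affine transformations whose linear part has determinant $1$ and defines a group isomorphism $\mathrm{Hes}\to\mathrm{SAff}(\mathbb F_3^2)$ onto the group of all such transformations. -/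

import Mathlib

open scoped LinearAlgebra.Projectivization MatrixGroups Pointwise

noncomputable section

namespace PlaneCubics

/-! ### Zariski topology on a projective space -/

section Zariski

variable {K W : Type*} [Field K] [AddCommGroup W] [Module K W]

/-- The value at `w : W` of a polynomial in the linear coordinate functions on `W`. -/
def evalDual (P : MvPolynomial (Module.Dual K W) K) (w : W) : K :=
  MvPolynomial.eval (fun φ : Module.Dual K W => φ w) P

/-- The common zero set in `ℙ K W` of a family of polynomials in the linear coordinate functions
(to be used for homogeneous polynomials only). -/
def projZeroLocus (T : Set (MvPolynomial (Module.Dual K W) K)) : Set (ℙ K W) :=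
  {x | ∀ P ∈ T, evalDual P x.rep = 0}

/-- Zariski closed subsets of `ℙ K W`: common zero sets of families of homogeneous polynomials. -/
def IsZariskiClosed (Z : Set (ℙ K W)) : Prop :=
  ∃ T : Set (MvPolynomial (Module.Dual K W) K),
    (∀ P ∈ T, ∃ n, P.IsHomogeneous n) ∧ Z = projZeroLocus T

/-- The Zariski topology on `ℙ K W`. -/
instance zariskiTopology : TopologicalSpace (ℙ K W) :=
  TopologicalSpace.ofClosed {Z | IsZariskiClosed Z}
    (by
      refine ⟨{1}, ?_, ?_⟩
      · rintro P rfl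
        exact ⟨0, MvPolynomial.isHomogeneous_one _ _⟩
      · ext x
        simp [projZeroLocus, evalDual])
    (by
      intro A hA
      refine ⟨{P | (∃ n, P.IsHomogeneous n) ∧ ∃ Z ∈ A, ∀ x ∈ Z, evalDual P x.rep = 0},
        fun P hP => hP.1, ?_⟩
      ext x
      simp only [Set.mem_sInter]
      constructor
      · rintro h P ⟨-, Z, hZ, hP⟩
        exact hP x (h Z hZ)
      · intro h Z hZ
        obtain ⟨T, hT, rfl⟩ := hA hZ
        intro P hP
        exact h P ⟨hT P hP, _, hZ, fun y hy => hy P hP⟩)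
    (by
      rintro _ ⟨T, hT, rfl⟩ _ ⟨T', hT', rfl⟩
      refine ⟨{P | ∃ Q ∈ T, ∃ Q' ∈ T', P = Q * Q'}, ?_, ?_⟩
      · rintro _ ⟨Q, hQ, Q', hQ', rfl⟩
        obtain ⟨n, hn⟩ := hT Q hQ
        obtain ⟨n', hn'⟩ := hT' Q' hQ'
        exact ⟨n + n', hn.mul hn'⟩
      · ext x
        constructor
        · rintro (h | h) _ ⟨Q, hQ, Q', hQ', rfl⟩
          · have := h Q hQ
            simp only [evalDual] at this
            simp [evalDual, this]
          · have := h Q' hQ'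
            simp only [evalDual] at this
            simp [evalDual, this]
        · intro h
          by_contra hc
          simp only [Set.mem_union, not_or] at hc
          obtain ⟨hc1, hc2⟩ := hc
          obtain ⟨Q, hQ, h1⟩ : ∃ Q ∈ T, evalDual Q x.rep ≠ 0 := by
            by_contra! hn
            exact hc1 hn
          obtain ⟨Q', hQ', h2⟩ : ∃ Q ∈ T', evalDual Q x.rep ≠ 0 := by
            by_contra! hn
            exact hc2 hn
          have := h _ ⟨Q, hQ, Q', hQ', rfl⟩
          simp only [evalDual, map_mul, mul_eq_zero] at this
          exact this.elim h1 h2)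

end Zariski

/-! ### Normalizers and relative sections -/

section RelativeSection

variable (R : Type*) {M : Type*} [Group R] [MulAction R M]

/-- `N_{R, B} = {r ∈ R ∣ r · B ⊆ B}`. -/
def normalizer (B : Set M) : Set R :=
  {r | r • B ⊆ B}

/-- A closed subset `S` of `M` is a relative section for the action of `R` on `M` if the
`R`-orbit of every irreducible component of `S` is dense in `M` and there is a dense open subset
`S₀` of `S` such that every `r` with `r · S₀ ∩ S₀ ≠ ∅` lies in `N_{R, S}`. -/
structure IsRelativeSection [TopologicalSpace M] (S : Set M) : Prop where
  isClosed : IsClosed S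
  dense_component : ∀ Z ∈ irreducibleComponents S,
    closure ((Set.univ : Set R) • (Subtype.val '' Z : Set M)) = Set.univ
  exists_open : ∃ S₀ : Set S, IsOpen S₀ ∧ Dense S₀ ∧
    ∀ r : R, ((r • (Subtype.val '' S₀ : Set M)) ∩ (Subtype.val '' S₀ : Set M)).Nonempty →
      r ∈ normalizer R S

end RelativeSection

/-! ### The special affine group -/

/-- The group of affine transformations of `P` whose linear part has determinant `1`. -/
def SAff (k : Type*) {A : Type*} (P : Type*) [Field k] [AddCommGroup A] [Module k A]
    [AddTorsor A P] : Subgroup (P ≃ᵃ[k] P) :=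
  (LinearEquiv.det.comp AffineEquiv.linearHom).ker

/-! ### Cubic forms and the action of `PSL(3, ℂ)` -/

/-- The space `U` of cubic forms on `ℂ³`. -/
abbrev CubicForm : Type := MvPolynomial.homogeneousSubmodule (Fin 3) ℂ 3

/-- The linear substitution `f ↦ (v ↦ f (A v))`. -/
def subst (A : Matrix (Fin 3) (Fin 3) ℂ) :
    MvPolynomial (Fin 3) ℂ →ₐ[ℂ] MvPolynomial (Fin 3) ℂ :=
  MvPolynomial.aeval fun i => ∑ j, MvPolynomial.C (A i j) * MvPolynomial.X j

lemma subst_one (f : MvPolynomial (Fin 3) ℂ) : subst 1 f = f := by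
  have : subst 1 = AlgHom.id ℂ _ := by
    apply MvPolynomial.algHom_ext
    intro i
    simp [subst, Matrix.one_apply]
  rw [this]
  rfl

lemma subst_subst (A B : Matrix (Fin 3) (Fin 3) ℂ) (f : MvPolynomial (Fin 3) ℂ) :
    subst A (subst B f) = subst (B * A) f := by
  have : (subst A).comp (subst B) = subst (B * A) := by
    apply MvPolynomial.algHom_ext
    intro i
    simp only [subst, AlgHom.comp_apply, MvPolynomial.aeval_X, map_sum, map_mul,
      MvPolynomial.algHom_C, MvPolynomial.algebraMap_eq, Matrix.mul_apply, Finset.mul_sum,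
      Finset.sum_mul]
    rw [Finset.sum_comm]
    simp only [mul_assoc]
  rw [← this]
  rfl

lemma subst_isHomogeneous (A : Matrix (Fin 3) (Fin 3) ℂ) {f : MvPolynomial (Fin 3) ℂ}
    (hf : f.IsHomogeneous 3) : (subst A f).IsHomogeneous 3 := by
  have := hf.aeval (n := 1) (fun i => ∑ j, MvPolynomial.C (A i j) * MvPolynomial.X j)
    (fun i => MvPolynomial.IsHomogeneous.sum _ _ _ fun j _ =>
      (MvPolynomial.isHomogeneous_X ℂ j).C_mul (A i j))
  simpa [subst] using this

lemma eval_subst (A : Matrix (Fin 3) (Fin 3) ℂ) (f : MvPolynomial (Fin 3) ℂ) (v : Fin 3 → ℂ) :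
    MvPolynomial.eval v (subst A f) = MvPolynomial.eval (A.mulVec v) f := by
  have : ((MvPolynomial.aeval v).comp (subst A)) = MvPolynomial.aeval (A.mulVec v) := by
    apply MvPolynomial.algHom_ext
    intro i
    simp [subst, Matrix.mulVec, dotProduct]
  simpa [MvPolynomial.aeval_eq_eval] using DFunLike.congr_fun this f

/-- The action of `SL(3, ℂ)` on cubic forms, `(g · f) (v) = f (g⁻¹ v)`. -/
instance : DistribMulAction SL(3, ℂ) CubicForm where
  smul g f := ⟨subst (g⁻¹ : SL(3, ℂ)).1 f.1, subst_isHomogeneous _ f.2⟩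
  one_smul f := Subtype.ext (by
    change subst ((1 : SL(3, ℂ))⁻¹).1 f.1 = f.1
    rw [inv_one]
    exact subst_one _)
  mul_smul g h f := Subtype.ext (by
    change subst ((g * h)⁻¹).1 f.1 = subst (g⁻¹).1 (subst (h⁻¹).1 f.1)
    rw [subst_subst, mul_inv_rev]
    rfl)
  smul_zero g := Subtype.ext (map_zero (subst _))
  smul_add g f f' := Subtype.ext (map_add (subst _) _ _)

lemma coe_smul (g : SL(3, ℂ)) (f : CubicForm) :
    ((g • f : CubicForm) : MvPolynomial (Fin 3) ℂ) = subst (g⁻¹ : SL(3, ℂ)).1 f.1 := rfl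

instance : SMulCommClass SL(3, ℂ) ℂ CubicForm where
  smul_comm g c f := Subtype.ext (map_smul (subst (g⁻¹ : SL(3, ℂ)).1) c f.1)

lemma center_smul {g : SL(3, ℂ)} (hg : g ∈ Subgroup.center SL(3, ℂ)) (x : ℙ ℂ CubicForm) :
    g • x = x := by
  induction x using Projectivization.ind with
  | _ f hf =>
    rw [Projectivization.smul_mk, Projectivization.mk_eq_mk_iff']
    obtain ⟨r, hr, hrg⟩ := Matrix.SpecialLinearGroup.mem_center_iff.1 (inv_mem hg)
    refine ⟨1, ?_⟩
    rw [one_smul]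
    apply Subtype.ext
    rw [coe_smul, ← hrg]
    apply MvPolynomial.funext
    intro v
    have h3 : r ^ 3 = 1 := by simpa using hr
    rw [eval_subst]
    have hv : (Matrix.scalar (Fin 3) r).mulVec v = fun i => r * v i := by
      ext i
      simp [Matrix.scalar_apply, Matrix.mulVec_diagonal]
    rw [hv]
    have hf3 : (f : MvPolynomial (Fin 3) ℂ).IsHomogeneous 3 := f.2
    have key : MvPolynomial.eval (fun i => r * v i) (f : MvPolynomial (Fin 3) ℂ) =
        r ^ 3 * MvPolynomial.eval v (f : MvPolynomial (Fin 3) ℂ) := by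
      rw [MvPolynomial.eval_eq, MvPolynomial.eval_eq, Finset.mul_sum]
      refine Finset.sum_congr rfl fun d hd => ?_
      have hd3 : ∑ i ∈ d.support, d i = 3 := by
        have := hf3 (MvPolynomial.mem_support_iff.1 hd)
        simpa [Finsupp.weight_apply, Finsupp.sum] using this
      simp only [mul_pow, Finset.prod_mul_distrib, Finset.prod_pow_eq_pow_sum, hd3]
      ring
    rw [key, h3, one_mul]

/-- The action of `PSL(3, ℂ)` on `ℙ(U)` induced by the action of `SL(3, ℂ)`. -/
def toPermHom : PSL(3, ℂ) →* Equiv.Perm (ℙ ℂ CubicForm) :=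
  QuotientGroup.lift _ (MulAction.toPermHom SL(3, ℂ) (ℙ ℂ CubicForm)) fun _ hg =>
    Equiv.ext fun x => center_smul hg x

instance : MulAction PSL(3, ℂ) (ℙ ℂ CubicForm) :=
  MulAction.compHom _ toPermHom

lemma psl_smul (g : SL(3, ℂ)) (x : ℙ ℂ CubicForm) : (g : PSL(3, ℂ)) • x = g • x := rfl

/-! ### Plane curves and flexes -/

/-- The zero set in `ℙ(ℂ³)` of a form on `ℂ³`. -/
def curve (f : MvPolynomial (Fin 3) ℂ) : Set (ℙ ℂ (Fin 3 → ℂ)) :=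
  {p | MvPolynomial.eval p.rep f = 0}

/-- The Hessian determinant of `f`. -/
def hessian (f : MvPolynomial (Fin 3) ℂ) : MvPolynomial (Fin 3) ℂ :=
  (Matrix.of fun i j => MvPolynomial.pderiv i (MvPolynomial.pderiv j f)).det

/-- The flexes of the curve `f = 0`: its intersection with the curve defined by the Hessian. -/
def flexes (f : MvPolynomial (Fin 3) ℂ) : Set (ℙ ℂ (Fin 3 → ℂ)) :=
  curve f ∩ curve (hessian f)

/-- The plane curve defined by the form `f` is smooth (for a cubic: an elliptic curve). -/
def IsSmooth (f : MvPolynomial (Fin 3) ℂ) : Prop :=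
  ∀ v : Fin 3 → ℂ, v ≠ 0 → MvPolynomial.eval v f = 0 →
    ∃ i, MvPolynomial.eval v (MvPolynomial.pderiv i f) ≠ 0

/-! ### The Hesse pencil -/

open MvPolynomial in
/-- The form `α (x₀³ + x₁³ + x₂³) + β x₀ x₁ x₂`. -/
def hesseForm (α β : ℂ) : CubicForm :=
  ⟨C α * (X 0 ^ 3 + X 1 ^ 3 + X 2 ^ 3) + C β * (X 0 * X 1 * X 2), by
    have h (i : Fin 3) : (X i ^ 3 : MvPolynomial (Fin 3) ℂ).IsHomogeneous 3 := by
      simpa using (isHomogeneous_X ℂ i).pow 3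
    exact ((((h 0).add (h 1)).add (h 2)).C_mul α).add
      ((((isHomogeneous_X ℂ 0).mul (isHomogeneous_X ℂ 1)).mul (isHomogeneous_X ℂ 2)).C_mul β)⟩

/-- The line `ℓ ⊆ ℙ(U)`. -/
def hesseLine : Set (ℙ ℂ CubicForm) :=
  {x | ∃ (α β : ℂ) (h : hesseForm α β ≠ 0), x = Projectivization.mk ℂ (hesseForm α β) h}

/-- The Hesse pencil, as a set of plane cubics in `ℙ(ℂ³)`. -/
def hessePencil : Set (Set (ℙ ℂ (Fin 3 → ℂ))) :=
  {D | ∃ α β : ℂ, hesseForm α β ≠ 0 ∧ D = curve (hesseForm α β)}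

/-- The Hessian group: the subgroup of `PSL(3, ℂ)` of elements mapping the Hesse pencil
(as a set of plane cubics) onto itself. -/
def Hes : Subgroup PSL(3, ℂ) :=
  MulAction.stabilizer PSL(3, ℂ) hessePencil

/-- Homogeneous coordinates of the nine points `t_{i,j}`. -/
def flexVec (ε : ℂ) (a : Fin 2 → ZMod 3) : Fin 3 → ℂ :=
  if a 0 = 0 then ![0, -ε ^ (a 1).val, 1]
  else if a 0 = 1 then ![1, 0, -ε ^ (a 1).val]
  else ![-ε ^ (a 1).val, 1, 0]

lemma flexVec_ne_zero (ε : ℂ) (a : Fin 2 → ZMod 3) : flexVec ε a ≠ 0 := by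
  intro h
  have h0 := congrFun h 0
  have h1 := congrFun h 1
  have h2 := congrFun h 2
  unfold flexVec at h0 h1 h2
  split_ifs at h0 h1 h2 <;> simp at h0 h1 h2

/-- The labelling `(i, j) ↦ t_{i,j}` of the nine points by `𝔽₃²`. -/
def flexPoint (ε : ℂ) (a : Fin 2 → ZMod 3) : ℙ ℂ (Fin 3 → ℂ) :=
  Projectivization.mk ℂ (flexVec ε a) (flexVec_ne_zero ε a)

end PlaneCubics

end

/-!
The Hessian determinant is a covariant of weight `2`, and on the Hesse pencil it is explicit:
the Hessian of `f = α (x₀³ + x₁³ + x₂³) + β x₀x₁x₂` is again a member of the pencil, independent of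
`f` precisely when `α (27 α³ + β³) ≠ 0`. This has two consequences.

* A substitution `g` taking such an `f` to a member of the pencil takes its Hessian to a member of
  the pencil too, hence preserves the plane `L` spanned by the two
  (`stable_of_smul_hesseForm_mem`). So the open subset `α (27 α³ + β³) ≠ 0` of `ℓ` is the one needed
  for a relative section. It is dense because the projectivization of a linear subspace is
  irreducible.
* For smooth `f` the flexes, being the common zeros of `f` and its Hessian, are the common zeros of
  all members of the pencil, that is the nine points `t_{i,j}` (`flexes_eq_range`).

A cubic through the nine points lies in the pencil (`mem_hesseSpace_of_eval_flexVec`). So `g`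
preserves the line `ℓ`, or the set of curves of the pencil, if and only if it permutes the nine
points, and the three groups coincide.

The orbit of `ℓ` is dense because the tangent space at the Fermat cubic to the set of cubics
`g · f`, `f ∈ L`, contains all monomials `x_i² x_j` (moving `g`) and `x₀x₁x₂` (moving `f`), hence is
everything. By the inverse function theorem this set contains a ball, up to scalars, and no nonzero
polynomial vanishes on a ball (`evalDual_eq_zero_of_forall_smul`).

For the isomorphism with the special affine group, explicit matrices (a cyclic permutation of the
coordinates, `diag(1, ε², ε)`, `diag(ε^k, 1, 1)` and the discrete Fourier transform) induce on the
labels translations, shears and a rotation, and these act 2-transitively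
(`exists_realizable_map_pair`). Both a projective transformation permuting the nine points and a
unimodular affine transformation can therefore be normalized so as to fix the labels `(0, 0)` and
`(0, 1)`. After that, the former is `diag(ε^k, 1, 1)` up to a scalar (`exists_eq_smul_diagonal`),
the latter is a shear (`eq_shear_of_mem_SAff`), and these correspond to each other. This shows at
once that every element of the Hessian group acts by an affine transformation of determinant `1`,
that every such transformation occurs, and that the action is faithful.
-/

namespace PlaneCubics

/-! ### Linear subspaces of a projective space in the Zariski topology -/

section Zariski

variable {K W : Type*} [Field K] [AddCommGroup W] [Module K W]

lemma evalDual_smul {P : MvPolynomial (Module.Dual K W) K} {n : ℕ} (hP : P.IsHomogeneous n)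
    (c : K) (w : W) : evalDual P (c • w) = c ^ n * evalDual P w := by
  rw [evalDual, evalDual, MvPolynomial.eval_eq, MvPolynomial.eval_eq, Finset.mul_sum]
  refine Finset.sum_congr rfl fun d hd => ?_
  have hdn : ∑ i ∈ d.support, d i = n := by
    simpa [Finsupp.weight_apply, Finsupp.sum] using hP (MvPolynomial.mem_support_iff.1 hd)
  simp only [map_smul, smul_eq_mul, mul_pow, Finset.prod_mul_distrib,
    Finset.prod_pow_eq_pow_sum, hdn]
  ring

lemma exists_rep_mk_eq_smul {v : W} (hv : v ≠ 0) :
    ∃ c : K, c ≠ 0 ∧ (Projectivization.mk K v hv).rep = c • v := by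
  obtain ⟨c, hc⟩ := Projectivization.exists_smul_eq_mk_rep K v hv
  exact ⟨c, c.ne_zero, hc.symm⟩

lemma evalDual_rep_mk {P : MvPolynomial (Module.Dual K W) K} {n : ℕ} (hP : P.IsHomogeneous n)
    {v : W} (hv : v ≠ 0) :
    evalDual P (Projectivization.mk K v hv).rep = 0 ↔ evalDual P v = 0 := by
  obtain ⟨c, hc, h⟩ := exists_rep_mk_eq_smul (K := K) hv
  simp [h, evalDual_smul hP, hc]

lemma isClosed_iff_isZariskiClosed {Z : Set (ℙ K W)} : IsClosed Z ↔ IsZariskiClosed Z := by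
  rw [← isOpen_compl_iff]
  change IsZariskiClosed (Zᶜᶜ) ↔ _
  rw [compl_compl]

/-- The restriction of a polynomial function on `W` to the parametrized line `t ↦ u + t • v`. -/
noncomputable def linePoly (P : MvPolynomial (Module.Dual K W) K) (u v : W) : Polynomial K :=
  MvPolynomial.aeval
    (fun φ : Module.Dual K W => Polynomial.C (φ u) + Polynomial.C (φ v) * Polynomial.X) P

lemma eval_linePoly (P : MvPolynomial (Module.Dual K W) K) (u v : W) (t : K) :
    (linePoly P u v).eval t = evalDual P (u + t • v) := by
  have : ((Polynomial.aeval t).comp (MvPolynomial.aeval (R := K)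
      (fun φ : Module.Dual K W => Polynomial.C (φ u) + Polynomial.C (φ v) * Polynomial.X))) =
      MvPolynomial.aeval (fun φ : Module.Dual K W => φ (u + t • v)) := by
    apply MvPolynomial.algHom_ext
    intro φ
    simp only [AlgHom.comp_apply, MvPolynomial.aeval_X, map_add, map_mul, Polynomial.aeval_C,
      Polynomial.aeval_X, map_smul, smul_eq_mul, Algebra.algebraMap_self, RingHom.id_apply]
    ring
  have h := DFunLike.congr_fun this P
  rw [AlgHom.comp_apply, Polynomial.coe_aeval_eq_eval] at h
  rw [MvPolynomial.aeval_eq_eval] at h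
  exact h

/-- The projectivization of a linear subspace, as a subset of the projective space. -/
def projSubspace (S : Submodule K W) : Set (ℙ K W) :=
  {x | x.rep ∈ S}

lemma mk_mem_projSubspace {S : Submodule K W} {v : W} (hv : v ≠ 0) :
    Projectivization.mk K v hv ∈ projSubspace S ↔ v ∈ S := by
  obtain ⟨c, hc, h⟩ := exists_rep_mk_eq_smul (K := K) hv
  change _ ∈ S ↔ _
  rw [h, Submodule.smul_mem_iff _ hc]

lemma isClosed_projSubspace (S : Submodule K W) : IsClosed (projSubspace S) := by
  rw [isClosed_iff_isZariskiClosed]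
  refine ⟨{P | ∃ φ : Module.Dual K W, S ≤ LinearMap.ker φ ∧ P = MvPolynomial.X φ}, ?_, ?_⟩
  · rintro _ ⟨φ, -, rfl⟩
    exact ⟨1, MvPolynomial.isHomogeneous_X _ _⟩
  · ext x
    constructor
    · rintro hx _ ⟨φ, hφ, rfl⟩
      simpa [evalDual] using hφ hx
    · intro h
      by_contra hx
      obtain ⟨φ, hφ, hS⟩ := Submodule.exists_le_ker_of_notMem hx
      exact hφ (by simpa [evalDual] using h _ ⟨φ, hS, rfl⟩)

/-- Two nonempty open subsets of `ℙ(S)` meet: a line joining points of the two sets is not covered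
by the finitely many zeros of the polynomials defining their complements. -/
lemma isPreirreducible_projSubspace [Infinite K] (S : Submodule K W) :
    IsPreirreducible (projSubspace S) := by
  have key : ∀ (U : Set (ℙ K W)) (x : ℙ K W), IsOpen U → x ∈ U →
      ∃ P : MvPolynomial (Module.Dual K W) K, (∃ n, P.IsHomogeneous n) ∧ evalDual P x.rep ≠ 0 ∧
        ∀ y : ℙ K W, evalDual P y.rep ≠ 0 → y ∈ U := by
    intro U x hU hx
    obtain ⟨T, hT, hTU⟩ := isClosed_iff_isZariskiClosed.1 hU.isClosed_compl
    have : x ∉ projZeroLocus T := by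
      rw [← hTU]
      exact fun h => h hx
    obtain ⟨P, hP, hPx⟩ : ∃ P ∈ T, evalDual P x.rep ≠ 0 := by
      by_contra! hn
      exact this hn
    refine ⟨P, hT P hP, hPx, fun y hy => ?_⟩
    by_contra hyU
    have hy' : y ∈ projZeroLocus T := by
      rw [← hTU]
      exact hyU
    exact hy (hy' P hP)
  rintro U V hU hV ⟨x, hxS, hxU⟩ ⟨y, hyS, hyV⟩
  obtain ⟨P, ⟨n, hPn⟩, hPx, hP⟩ := key U x hU hxU
  obtain ⟨Q, ⟨m, hQm⟩, hQy, hQ⟩ := key V y hV hyV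
  obtain ⟨φ, hφ⟩ : ∃ φ : Module.Dual K W, φ x.rep ≠ 0 := by
    by_contra! h
    exact x.rep_nonzero ((Module.forall_dual_apply_eq_zero_iff K _).1 h)
  -- the third factor keeps `x.rep + t • (y.rep - x.rep)` away from `0`
  have h1 : linePoly P x.rep (y.rep - x.rep) ≠ 0 := by
    intro h
    have := eval_linePoly P x.rep (y.rep - x.rep) 0
    simp [h] at this
    exact hPx this.symm
  have h2 : linePoly Q x.rep (y.rep - x.rep) ≠ 0 := by
    intro h
    have := eval_linePoly Q x.rep (y.rep - x.rep) 1
    simp [h] at this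
    exact hQy this.symm
  have h3 : linePoly (MvPolynomial.X φ) x.rep (y.rep - x.rep) ≠ 0 := by
    intro h
    have := eval_linePoly (MvPolynomial.X φ) x.rep (y.rep - x.rep) 0
    simp [h, evalDual] at this
    exact hφ this.symm
  obtain ⟨t, ht⟩ := Polynomial.exists_eval_ne_zero_of_natDegree_lt_card _
    (mul_ne_zero (mul_ne_zero h1 h2) h3) ((Cardinal.natCast_lt_aleph0).trans_le
      (Cardinal.aleph0_le_mk K))
  simp only [Polynomial.eval_mul, eval_linePoly, mul_ne_zero_iff] at ht
  obtain ⟨⟨ht1, ht2⟩, ht3⟩ := ht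
  have hz : x.rep + t • (y.rep - x.rep) ≠ 0 := by
    intro h
    simp [h, evalDual] at ht3
  refine ⟨Projectivization.mk K _ hz, ?_, hP _ ?_, hQ _ ?_⟩
  · rw [mk_mem_projSubspace]
    exact S.add_mem hxS (S.smul_mem _ (S.sub_mem hyS hxS))
  · rwa [Ne, evalDual_rep_mk hPn]
  · rwa [Ne, evalDual_rep_mk hQm]

/-- A polynomial vanishing near a point, in the sense that its restriction to every line through
that point has infinitely many zeros, vanishes identically. -/
lemma evalDual_eq_zero_of_lines {P : MvPolynomial (Module.Dual K W) K} {u : W}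
    (h : ∀ v, {t : K | evalDual P (u + t • v) = 0}.Infinite) (w : W) : evalDual P w = 0 := by
  have h0 : linePoly P u (w - u) = 0 := by
    refine Polynomial.eq_zero_of_infinite_isRoot _ ((h (w - u)).mono fun t ht => ?_)
    simpa [Polynomial.IsRoot, eval_linePoly] using ht
  have := eval_linePoly P u (w - u) 1
  simp [h0] at this
  exact this.symm

end Zariski

/-! ### Evaluation of forms at points -/

lemma eval_smul_of_isHomogeneous {f : MvPolynomial (Fin 3) ℂ} {n : ℕ} (hf : f.IsHomogeneous n)
    (c : ℂ) (v : Fin 3 → ℂ) :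
    MvPolynomial.eval (c • v) f = c ^ n * MvPolynomial.eval v f := by
  rw [MvPolynomial.eval_eq, MvPolynomial.eval_eq, Finset.mul_sum]
  refine Finset.sum_congr rfl fun d hd => ?_
  have hdn : ∑ i ∈ d.support, d i = n := by
    simpa [Finsupp.weight_apply, Finsupp.sum] using hf (MvPolynomial.mem_support_iff.1 hd)
  simp only [Pi.smul_apply, smul_eq_mul, mul_pow, Finset.prod_mul_distrib,
    Finset.prod_pow_eq_pow_sum, hdn]
  ring

lemma mk_mem_curve {f : MvPolynomial (Fin 3) ℂ} {n : ℕ} (hf : f.IsHomogeneous n)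
    {v : Fin 3 → ℂ} (hv : v ≠ 0) :
    Projectivization.mk ℂ v hv ∈ curve f ↔ MvPolynomial.eval v f = 0 := by
  obtain ⟨c, hc, h⟩ := exists_rep_mk_eq_smul (K := ℂ) hv
  change MvPolynomial.eval _ f = 0 ↔ _
  simp [h, eval_smul_of_isHomogeneous hf, hc]

lemma sl_smul_eq_mulVec (g : SL(3, ℂ)) (v : Fin 3 → ℂ) : g • v = g.1.mulVec v := rfl

lemma smul_curve (g : SL(3, ℂ)) (f : CubicForm) :
    (g : PSL(3, ℂ)) • curve (f : MvPolynomial (Fin 3) ℂ) =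
      curve ((g • f : CubicForm) : MvPolynomial (Fin 3) ℂ) := by
  ext p
  rw [Set.mem_smul_set_iff_inv_smul_mem]
  induction p using Projectivization.ind with
  | _ v hv =>
    change (g⁻¹ : SL(3, ℂ)) • Projectivization.mk ℂ v hv ∈ _ ↔ _
    rw [Projectivization.smul_mk, mk_mem_curve f.2, mk_mem_curve (g • f).2, coe_smul, eval_subst,
      sl_smul_eq_mulVec]

/-! ### The Hessian determinant -/

lemma pderiv_subst (A : Matrix (Fin 3) (Fin 3) ℂ) (f : MvPolynomial (Fin 3) ℂ) (i : Fin 3) :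
    MvPolynomial.pderiv i (subst A f) =
      ∑ k, MvPolynomial.C (A k i) * subst A (MvPolynomial.pderiv k f) := by
  induction f using MvPolynomial.induction_on with
  | C a => simp [subst, MvPolynomial.algHom_C, MvPolynomial.algebraMap_eq]
  | add p q hp hq =>
    simp only [map_add, hp, hq, mul_add, Finset.sum_add_distrib]
  | mul_X p n hp =>
    have hX : MvPolynomial.pderiv i (subst A (MvPolynomial.X n)) = MvPolynomial.C (A n i) := by
      simp [subst, MvPolynomial.pderiv_X, Pi.single_apply]
    have hk (k : Fin 3) : subst A (MvPolynomial.pderiv k (p * MvPolynomial.X n)) =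
        subst A p * (if k = n then 1 else 0) +
          subst A (MvPolynomial.X n) * subst A (MvPolynomial.pderiv k p) := by
      rw [Derivation.leibniz, MvPolynomial.pderiv_X, smul_eq_mul, smul_eq_mul, map_add, map_mul,
        map_mul, Pi.single_apply]
      split_ifs with h1 h2 h2
      · rw [map_one]
      · exact absurd h1.symm h2
      · exact absurd h2.symm h1
      · rw [map_zero]
    rw [map_mul, Derivation.leibniz, hp, hX]
    simp only [hk, Fin.sum_univ_three, smul_eq_mul]
    fin_cases n <;> simp <;> ring

/-- The Hessian determinant is a covariant of weight `2`. -/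
lemma hessian_subst (A : Matrix (Fin 3) (Fin 3) ℂ) (f : MvPolynomial (Fin 3) ℂ) :
    hessian (subst A f) = MvPolynomial.C (A.det ^ 2) * subst A (hessian f) := by
  have h : (Matrix.of fun i j => MvPolynomial.pderiv i (MvPolynomial.pderiv j (subst A f))) =
      (A.map MvPolynomial.C).transpose *
        ((subst A).mapMatrix (Matrix.of fun i j =>
          MvPolynomial.pderiv i (MvPolynomial.pderiv j f))) * A.map MvPolynomial.C := by
    ext1 i j
    simp only [Matrix.of_apply, pderiv_subst, map_sum, Matrix.mul_apply, Matrix.transpose_apply,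
      Matrix.map_apply, AlgHom.mapMatrix_apply, Derivation.leibniz, MvPolynomial.pderiv_C,
      smul_eq_mul, mul_zero, add_zero, Finset.mul_sum, Finset.sum_mul]
    refine Finset.sum_congr rfl fun k _ => Finset.sum_congr rfl fun l _ => ?_
    ring
  have hd : (A.map (MvPolynomial.C (σ := Fin 3))).det = MvPolynomial.C A.det :=
    (RingHom.map_det MvPolynomial.C A).symm
  rw [hessian, h, Matrix.det_mul, Matrix.det_mul, Matrix.det_transpose, hd, ← AlgHom.map_det,
    hessian, map_pow]
  ring

open MvPolynomial in
lemma coe_hesseForm (α β : ℂ) : (hesseForm α β : MvPolynomial (Fin 3) ℂ) =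
    C α * (X 0 ^ 3 + X 1 ^ 3 + X 2 ^ 3) + C β * (X 0 * X 1 * X 2) := rfl

lemma eval_hesseForm (α β : ℂ) (v : Fin 3 → ℂ) :
    MvPolynomial.eval v (hesseForm α β : MvPolynomial (Fin 3) ℂ) =
      α * (v 0 ^ 3 + v 1 ^ 3 + v 2 ^ 3) + β * (v 0 * v 1 * v 2) := by
  simp [coe_hesseForm]

/-- The Hessian of a member of the Hesse pencil is again in the pencil. -/
lemma hessian_hesseForm (α β : ℂ) : hessian (hesseForm α β : MvPolynomial (Fin 3) ℂ) =
    hesseForm (-6 * α * β ^ 2) (216 * α ^ 3 + 2 * β ^ 3) := by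
  apply MvPolynomial.funext
  intro v
  rw [eval_hesseForm, hessian, coe_hesseForm, RingHom.map_det, Matrix.det_fin_three]
  have h3 (i : Fin 3) : MvPolynomial.pderiv i (3 : MvPolynomial (Fin 3) ℂ) = 0 := by
    exact_mod_cast Derivation.map_natCast (MvPolynomial.pderiv (R := ℂ) i) 3
  simp [MvPolynomial.pderiv_X, Pi.single_apply, Derivation.leibniz, Derivation.leibniz_pow, h3]
  ring

/-! ### The plane of forms spanned by the Hesse pencil -/

/-- The plane `L` of cubic forms whose projectivization is the line `ℓ`. -/
noncomputable def hesseSpace : Submodule ℂ CubicForm :=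
  Submodule.span ℂ {hesseForm 1 0, hesseForm 0 1}

lemma hesseForm_eq (α β : ℂ) : hesseForm α β = α • hesseForm 1 0 + β • hesseForm 0 1 := by
  apply Subtype.ext
  apply MvPolynomial.funext
  intro v
  simp [eval_hesseForm]

lemma mem_hesseSpace {f : CubicForm} : f ∈ hesseSpace ↔ ∃ α β, f = hesseForm α β := by
  rw [hesseSpace, Submodule.mem_span_pair]
  exact exists₂_congr fun α β => by rw [← hesseForm_eq, eq_comm]

lemma hesseForm_mem (α β : ℂ) : hesseForm α β ∈ hesseSpace := mem_hesseSpace.2 ⟨α, β, rfl⟩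

lemma hesseForm_ne_zero_iff {α β : ℂ} : hesseForm α β ≠ 0 ↔ α ≠ 0 ∨ β ≠ 0 := by
  rw [← not_and_or, not_iff_not]
  constructor
  · intro h
    have h' : ∀ v : Fin 3 → ℂ, α * (v 0 ^ 3 + v 1 ^ 3 + v 2 ^ 3) + β * (v 0 * v 1 * v 2) = 0 := by
      intro v
      rw [← eval_hesseForm, h]
      simp
    have h1 : α = 0 := by simpa using h' ![1, 0, 0]
    exact ⟨h1, by simpa [h1] using h' ![1, 1, 1]⟩
  · rintro ⟨rfl, rfl⟩
    rw [hesseForm_eq]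
    simp

lemma hesseLine_eq_projSubspace : hesseLine = projSubspace hesseSpace := by
  ext x
  induction x using Projectivization.ind with
  | _ f hf =>
    rw [mk_mem_projSubspace, mem_hesseSpace]
    constructor
    · rintro ⟨α, β, h, hx⟩
      obtain ⟨c, rfl⟩ := (Projectivization.mk_eq_mk_iff' ℂ _ _ _ _).1 hx
      exact mem_hesseSpace.1 (hesseSpace.smul_mem c (hesseForm_mem α β))
    · rintro ⟨α, β, rfl⟩
      exact ⟨α, β, hf, rfl⟩

lemma mk_mem_hesseLine {f : CubicForm} (hf : f ≠ 0) :
    Projectivization.mk ℂ f hf ∈ hesseLine ↔ f ∈ hesseSpace := by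
  rw [hesseLine_eq_projSubspace, mk_mem_projSubspace]

lemma smul_ne_zero_of_form (g : SL(3, ℂ)) {f : CubicForm} (hf : f ≠ 0) : g • f ≠ 0 :=
  (smul_ne_zero_iff_ne g).2 hf

lemma mk_mem_normalizer_hesseLine {g : SL(3, ℂ)} :
    (g : PSL(3, ℂ)) ∈ normalizer PSL(3, ℂ) hesseLine ↔ ∀ f ∈ hesseSpace, g • f ∈ hesseSpace := by
  constructor
  · intro h f hf
    by_cases hf0 : f = 0
    · rw [hf0, smul_zero]
      exact hesseSpace.zero_mem
    · have := h (Set.smul_mem_smul_set ((mk_mem_hesseLine hf0).2 hf))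
      rwa [psl_smul, Projectivization.smul_mk, mk_mem_hesseLine] at this
  · rintro h _ ⟨x, hx, rfl⟩
    induction x using Projectivization.ind with
    | _ f hf =>
      change g • Projectivization.mk ℂ f hf ∈ _
      rw [Projectivization.smul_mk, mk_mem_hesseLine]
      exact h f ((mk_mem_hesseLine hf).1 hx)

/-- By finite dimensionality, a linear substitution mapping `L` into itself maps it onto itself. -/
lemma exists_smul_eq_of_stable {g : SL(3, ℂ)} (h : ∀ f ∈ hesseSpace, g • f ∈ hesseSpace)
    {f : CubicForm} (hf : f ∈ hesseSpace) : ∃ f' ∈ hesseSpace, g • f' = f := by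
  have : FiniteDimensional ℂ hesseSpace :=
    FiniteDimensional.span_of_finite ℂ (Set.toFinite _)
  let T : hesseSpace →ₗ[ℂ] hesseSpace := (DistribSMul.toLinearMap ℂ CubicForm g).restrict h
  have hinj : Function.Injective T := by
    intro x y hxy
    exact Subtype.ext (MulAction.injective g (congrArg Subtype.val hxy))
  have hsurj : Function.Surjective T := by
    exact LinearMap.surjective_of_injective (K := ℂ) (V := hesseSpace) (f := T) hinj
  obtain ⟨f', hf'⟩ := hsurj ⟨f, hf⟩
  exact ⟨f', f'.2, congrArg Subtype.val hf'⟩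

lemma mk_mem_Hes_of_stable {g : SL(3, ℂ)} (h : ∀ f ∈ hesseSpace, g • f ∈ hesseSpace) :
    (g : PSL(3, ℂ)) ∈ Hes := by
  rw [Hes, MulAction.mem_stabilizer_iff]
  ext D
  constructor
  · rintro ⟨_, ⟨α, β, h0, rfl⟩, rfl⟩
    obtain ⟨α', β', hg⟩ := mem_hesseSpace.1 (h _ (hesseForm_mem α β))
    refine ⟨α', β', ?_, ?_⟩
    · rw [← hg]
      exact smul_ne_zero_of_form g h0
    · change (g : PSL(3, ℂ)) • curve _ = _
      rw [smul_curve, hg]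
  · rintro ⟨α, β, h0, rfl⟩
    obtain ⟨f, hf, hgf⟩ := exists_smul_eq_of_stable h (hesseForm_mem α β)
    obtain ⟨α', β', rfl⟩ := mem_hesseSpace.1 hf
    refine ⟨_, ⟨α', β', ?_, rfl⟩, ?_⟩
    · rintro h1
      rw [h1, smul_zero] at hgf
      exact h0 hgf.symm
    · change (g : PSL(3, ℂ)) • curve _ = _
      rw [smul_curve, hgf]

/-- A substitution mapping a member `f` of the pencil with `f` and its Hessian independent to
another member of the pencil preserves the plane `L`, because `L` is spanned by `f` and its
Hessian, and the Hessian is covariant. -/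
lemma stable_of_smul_hesseForm_mem {g : SL(3, ℂ)} {α β : ℂ}
    (hD : α * (27 * α ^ 3 + β ^ 3) ≠ 0) (h : g • hesseForm α β ∈ hesseSpace) :
    ∀ f ∈ hesseSpace, g • f ∈ hesseSpace := by
  have hH : g • hesseForm (-6 * α * β ^ 2) (216 * α ^ 3 + 2 * β ^ 3) ∈ hesseSpace := by
    obtain ⟨α', β', hg⟩ := mem_hesseSpace.1 h
    refine mem_hesseSpace.2 ⟨-6 * α' * β' ^ 2, 216 * α' ^ 3 + 2 * β' ^ 3, Subtype.ext ?_⟩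
    rw [← hessian_hesseForm, ← hg, coe_smul, coe_smul, hessian_subst, ← hessian_hesseForm,
      (g⁻¹).2]
    simp
  intro f hf
  obtain ⟨γ, δ, rfl⟩ := mem_hesseSpace.1 hf
  -- Cramer's rule for the basis `f, H(f)` of `L`
  have hDet : α * (216 * α ^ 3 + 2 * β ^ 3) - β * (-6 * α * β ^ 2) ≠ 0 := by
    intro h0
    exact hD (by linear_combination h0 / 8)
  set Δ := α * (216 * α ^ 3 + 2 * β ^ 3) - β * (-6 * α * β ^ 2) with hΔ
  have hcomb : hesseForm γ δ =
      ((γ * (216 * α ^ 3 + 2 * β ^ 3) - δ * (-6 * α * β ^ 2)) / Δ) • hesseForm α β +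
      ((α * δ - β * γ) / Δ) • hesseForm (-6 * α * β ^ 2) (216 * α ^ 3 + 2 * β ^ 3) := by
    apply Subtype.ext
    apply MvPolynomial.funext
    intro v
    simp only [Submodule.coe_add, Submodule.coe_smul, map_add, MvPolynomial.smul_eval,
      eval_hesseForm]
    field_simp
    rw [hΔ]
    ring
  rw [hcomb, smul_add, smul_comm g, smul_comm g]
  exact hesseSpace.add_mem (hesseSpace.smul_mem _ h) (hesseSpace.smul_mem _ hH)

/-- If `α = 0`, the curve is singular at `(1 : 0 : 0)`; if `27 α³ + β³ = 0` and `α ≠ 0`, it is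
singular at `(1 : 1 : c²)`, where `c = -β / (3 α)` is a cube root of unity. -/
lemma discr_ne_zero_of_isSmooth {α β : ℂ}
    (h : IsSmooth (hesseForm α β : MvPolynomial (Fin 3) ℂ)) : α * (27 * α ^ 3 + β ^ 3) ≠ 0 := by
  have hgrad : ∀ v : Fin 3 → ℂ, v ≠ 0 →
      3 * α * v 0 ^ 2 + β * (v 1 * v 2) = 0 → 3 * α * v 1 ^ 2 + β * (v 0 * v 2) = 0 →
      3 * α * v 2 ^ 2 + β * (v 0 * v 1) = 0 → False := by
    intro v hv h0 h1 h2
    obtain ⟨i, hi⟩ := h v hv (by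
      rw [eval_hesseForm]
      linear_combination (v 0 * h0 + v 1 * h1 + v 2 * h2) / 3)
    apply hi
    rw [coe_hesseForm]
    fin_cases i <;>
      simp [MvPolynomial.pderiv_X, Derivation.leibniz, Derivation.leibniz_pow]
    · linear_combination h0
    · linear_combination h1
    · linear_combination h2
  intro hD
  rcases eq_or_ne α 0 with rfl | hα
  · exact hgrad ![1, 0, 0] (fun h => by simpa using congrFun h 0) (by simp) (by simp) (by simp)
  · have h3 : 27 * α ^ 3 + β ^ 3 = 0 := (mul_eq_zero.1 hD).resolve_left hα
    refine hgrad ![1, 1, (-β / (3 * α)) ^ 2] (fun h => by simpa using congrFun h 0) ?_ ?_ ?_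
    · simp
      field_simp
      linear_combination h3
    · simp
      field_simp
      linear_combination h3
    · simp
      field_simp
      linear_combination β * h3

/-! ### Coordinates on the space of cubic forms -/

open MvPolynomial in
/-- The cubic form `∑ i j, c i j * x_i² x_j + d * x₀ x₁ x₂`. -/
noncomputable def cubicOfCoeffs : ((Fin 3 → Fin 3 → ℂ) × ℂ) →ₗ[ℂ] CubicForm where
  toFun c := ⟨∑ i, ∑ j, C (c.1 i j) * (X i ^ 2 * X j) + C c.2 * (X 0 * X 1 * X 2), by
    refine (IsHomogeneous.sum _ _ _ fun i _ => IsHomogeneous.sum _ _ _ fun j _ => ?_).add ?_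
    · exact (((isHomogeneous_X ℂ i).pow 2).mul (isHomogeneous_X ℂ j)).C_mul _
    · exact (((isHomogeneous_X ℂ 0).mul (isHomogeneous_X ℂ 1)).mul (isHomogeneous_X ℂ 2)).C_mul _⟩
  map_add' c c' := Subtype.ext (by
    simp only [Prod.fst_add, Prod.snd_add, Pi.add_apply, C_add, add_mul, Finset.sum_add_distrib,
      Submodule.coe_add]
    ring)
  map_smul' a c := Subtype.ext (by
    simp only [Prod.smul_fst, Prod.smul_snd, Pi.smul_apply, smul_eq_mul, C_mul, Submodule.coe_smul,
      RingHom.id_apply, MvPolynomial.smul_eq_C_mul, mul_add, Finset.mul_sum, mul_assoc])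

lemma eval_cubicOfCoeffs (c : (Fin 3 → Fin 3 → ℂ) × ℂ) (v : Fin 3 → ℂ) :
    MvPolynomial.eval v (cubicOfCoeffs c : MvPolynomial (Fin 3) ℂ) =
      ∑ i, ∑ j, c.1 i j * (v i ^ 2 * v j) + c.2 * (v 0 * v 1 * v 2) := by
  change MvPolynomial.eval v (∑ i, ∑ j, MvPolynomial.C (c.1 i j) * _ + _) = _
  simp

lemma cubicForm_ext {f f' : CubicForm}
    (h : ∀ v, MvPolynomial.eval v (f : MvPolynomial (Fin 3) ℂ) =
      MvPolynomial.eval v (f' : MvPolynomial (Fin 3) ℂ)) : f = f' :=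
  Subtype.ext (MvPolynomial.funext h)

lemma cubicOfCoeffs_surjective : Function.Surjective cubicOfCoeffs := by
  have hmon : ∀ (d : Fin 3 →₀ ℕ) (a : ℂ), d 0 + d 1 + d 2 = 3 →
      ∃ c, (cubicOfCoeffs c : MvPolynomial (Fin 3) ℂ) = MvPolynomial.monomial d a := by
    intro d a hd
    have hev : ∀ v : Fin 3 → ℂ, MvPolynomial.eval v (MvPolynomial.monomial d a) =
        a * (v 0 ^ d 0 * v 1 ^ d 1 * v 2 ^ d 2) := by
      intro v
      rw [MvPolynomial.eval_monomial, Finsupp.prod_fintype _ _ (by simp), Fin.prod_univ_three]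
    have hsq : ∀ i j : Fin 3,
        (∀ v : Fin 3 → ℂ, v 0 ^ d 0 * v 1 ^ d 1 * v 2 ^ d 2 = v i ^ 2 * v j) →
        ∃ c, (cubicOfCoeffs c : MvPolynomial (Fin 3) ℂ) = MvPolynomial.monomial d a := by
      intro i j h
      refine ⟨(fun k l => if k = i ∧ l = j then a else 0, 0), MvPolynomial.funext fun v => ?_⟩
      rw [hev, h, eval_cubicOfCoeffs, Finset.sum_eq_single i, Finset.sum_eq_single j]
      · simp
      · intro l _ hl
        simp [hl]
      · simp
      · intro k _ hk
        simp [hk]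
      · simp
    generalize d 0 = d0, d 1 = d1, d 2 = d2 at hd hev hsq
    have h0 : d0 ≤ 3 := by omega
    have h1 : d1 ≤ 3 := by omega
    obtain rfl : d2 = 3 - d0 - d1 := by omega
    by_cases hxyz : d0 = 1 ∧ d1 = 1
    · obtain ⟨rfl, rfl⟩ := hxyz
      refine ⟨(0, a), MvPolynomial.funext fun v => ?_⟩
      rw [hev, eval_cubicOfCoeffs]
      simp
    · have : ∃ i j : Fin 3, ∀ v : Fin 3 → ℂ,
          v 0 ^ d0 * v 1 ^ d1 * v 2 ^ (3 - d0 - d1) = v i ^ 2 * v j := by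
        interval_cases d0 <;> interval_cases d1 <;> first | omega | skip
        · exact ⟨2, 2, fun v => by ring⟩
        · exact ⟨2, 1, fun v => by ring⟩
        · exact ⟨1, 2, fun v => by ring⟩
        · exact ⟨1, 1, fun v => by ring⟩
        · exact ⟨2, 0, fun v => by ring⟩
        · exact ⟨1, 0, fun v => by ring⟩
        · exact ⟨0, 2, fun v => by ring⟩
        · exact ⟨0, 1, fun v => by ring⟩
        · exact ⟨0, 0, fun v => by ring⟩
      obtain ⟨i, j, hij⟩ := this
      exact hsq i j hij
  intro f
  have hf : (f : MvPolynomial (Fin 3) ℂ) ∈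
      (LinearMap.range cubicOfCoeffs).map (Submodule.subtype _) := by
    rw [← MvPolynomial.support_sum_monomial_coeff (f : MvPolynomial (Fin 3) ℂ)]
    refine Submodule.sum_mem _ fun d hd => ?_
    have hd3 : d 0 + d 1 + d 2 = 3 := by
      have := f.2 (MvPolynomial.mem_support_iff.1 hd)
      rw [Finsupp.weight_apply, Finsupp.sum_fintype _ _ (by simp), Fin.sum_univ_three] at this
      simpa using this
    obtain ⟨c, hc⟩ := hmon d _ hd3
    exact ⟨_, ⟨c, rfl⟩, hc⟩
  obtain ⟨_, ⟨c, rfl⟩, hc⟩ := hf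
  exact ⟨c, Subtype.ext hc⟩

/-! ### The nine base points of the Hesse pencil -/

section

variable {ε : ℂ}

lemma sq_add_self_add_one (hε : IsPrimitiveRoot ε 3) : ε ^ 2 + ε + 1 = 0 := by
  have h := hε.geom_sum_eq_zero (by norm_num)
  simp only [Finset.sum_range_succ, Finset.sum_range_zero] at h
  linear_combination h

/-- The cube roots of unity are `1`, `ε`, `ε²`. -/
lemma exists_eq_pow_of_pow_three_eq_one (hε : IsPrimitiveRoot ε 3) {a : ℂ} (ha : a ^ 3 = 1) :
    ∃ j : ZMod 3, a = ε ^ j.val := by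
  obtain ⟨i, hi, rfl⟩ := hε.eq_pow_of_pow_eq_one ha
  refine ⟨(i : ZMod 3), ?_⟩
  rw [ZMod.val_natCast, Nat.mod_eq_of_lt hi]

lemma pow_val_injective (hε : IsPrimitiveRoot ε 3) {j k : ZMod 3} (h : ε ^ j.val = ε ^ k.val) :
    j = k :=
  ZMod.val_injective 3 (hε.pow_inj (ZMod.val_lt j) (ZMod.val_lt k) h)

lemma pow_val_pow_three (hε : IsPrimitiveRoot ε 3) (j : ZMod 3) : (ε ^ j.val) ^ 3 = 1 := by
  rw [← pow_mul, mul_comm, pow_mul, hε.pow_eq_one, one_pow]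

/-- A quadratic polynomial vanishing at the three cube roots of unity is zero. -/
lemma quadratic_eq_zero (hε : IsPrimitiveRoot ε 3) {p q r : ℂ}
    (h : ∀ j : ZMod 3, p + q * ε ^ j.val + r * (ε ^ j.val) ^ 2 = 0) : p = 0 ∧ q = 0 ∧ r = 0 := by
  have h2 := sq_add_self_add_one hε
  have e0 : p + q + r = 0 := by simpa using h 0
  have e1 : p + q * ε + r * ε ^ 2 = 0 := by simpa [ZMod.val_one] using h 1
  have e2 : p + q * ε ^ 2 + r * (ε ^ 2) ^ 2 = 0 := h 2
  refine ⟨?_, ?_, ?_⟩ <;> grind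

lemma fin_two_zmod_ext {a b : Fin 2 → ZMod 3} (h0 : a 0 = b 0) (h1 : a 1 = b 1) : a = b := by
  ext i
  fin_cases i <;> simp [h0, h1]

lemma zmod_three_cases (i : ZMod 3) : i = 0 ∨ i = 1 ∨ i = 2 := by
  revert i
  decide

lemma flexVec_zero (j : ZMod 3) : flexVec ε ![0, j] = ![0, -ε ^ j.val, 1] := by
  simp [flexVec]

lemma flexVec_one (j : ZMod 3) : flexVec ε ![1, j] = ![1, 0, -ε ^ j.val] := by
  simp [flexVec]

lemma flexVec_two (j : ZMod 3) : flexVec ε ![2, j] = ![-ε ^ j.val, 1, 0] := by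
  have h1 : (2 : ZMod 3) ≠ 0 := by decide
  have h2 : (2 : ZMod 3) ≠ 1 := by decide
  simp [flexVec, h1, h2]

/-- To prove a statement about all nine labels, treat the three triples `(i, ·)` separately. -/
lemma forall_label {p : (Fin 2 → ZMod 3) → Prop} :
    (∀ a, p a) ↔ (∀ j, p ![0, j]) ∧ (∀ j, p ![1, j]) ∧ ∀ j, p ![2, j] := by
  refine ⟨fun h => ⟨fun _ => h _, fun _ => h _, fun _ => h _⟩, fun ⟨h0, h1, h2⟩ a => ?_⟩
  have ha : a = ![a 0, a 1] := fin_two_zmod_ext rfl rfl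
  rw [ha]
  rcases zmod_three_cases (a 0) with h | h | h <;> rw [h]
  exacts [h0 _, h1 _, h2 _]

lemma flexPoint_injective (hε : IsPrimitiveRoot ε 3) : Function.Injective (flexPoint ε) := by
  have hpow : ∀ j : ZMod 3, ε ^ j.val ≠ 0 := fun j => pow_ne_zero _ (hε.ne_zero (by norm_num))
  suffices key : ∀ a b : Fin 2 → ZMod 3, flexPoint ε a = flexPoint ε b → a = b from
    fun a b h => key a b h
  have hmk : ∀ a b : Fin 2 → ZMod 3, flexPoint ε a = flexPoint ε b →
      ∃ c : ℂ, c • flexVec ε b = flexVec ε a := fun a b h =>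
    (Projectivization.mk_eq_mk_iff' ℂ _ _ _ _).1 h
  rw [forall_label]
  refine ⟨fun j => ?_, fun j => ?_, fun j => ?_⟩ <;> rw [forall_label] <;>
    refine ⟨fun k h => ?_, fun k h => ?_, fun k h => ?_⟩ <;> obtain ⟨c, hc⟩ := hmk _ _ h <;>
    simp only [flexVec_zero, flexVec_one, flexVec_two] at hc <;>
    have e0 := congrFun hc 0 <;> have e1 := congrFun hc 1 <;> have e2 := congrFun hc 2 <;>
    simp [hpow] at e0 e1 e2
  · rw [e2, one_mul] at e1
    rw [pow_val_injective hε e1]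
  · rw [e0, one_mul] at e2
    rw [pow_val_injective hε e2]
  · rw [e1, one_mul] at e0
    rw [pow_val_injective hε e0]

/-- The nine points are the common zeros of all members of the pencil. -/
lemma mem_range_flexPoint_iff (hε : IsPrimitiveRoot ε 3) {v : Fin 3 → ℂ} (hv : v ≠ 0) :
    Projectivization.mk ℂ v hv ∈ Set.range (flexPoint ε) ↔
      v 0 ^ 3 + v 1 ^ 3 + v 2 ^ 3 = 0 ∧ v 0 * v 1 * v 2 = 0 := by
  constructor
  · rintro ⟨a, ha⟩
    obtain ⟨c, rfl⟩ := (Projectivization.mk_eq_mk_iff' ℂ _ _ _ _).1 ha.symm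
    clear ha hv
    revert a
    rw [forall_label]
    refine ⟨fun j => ?_, fun j => ?_, fun j => ?_⟩ <;>
      simp only [flexVec_zero, flexVec_one, flexVec_two] <;>
      have := pow_val_pow_three hε j <;>
      simp <;> linear_combination -c ^ 3 * this
  · rintro ⟨hS, hP⟩
    -- a nonzero vector whose `k`-th coordinate vanishes, with `i, j` the other two
    have hroot : ∀ x y : ℂ, x ^ 3 + y ^ 3 = 0 → y ≠ 0 → ∃ j : ZMod 3, x = y * -ε ^ j.val := by
      intro x y hxy hy
      obtain ⟨j, hj⟩ := exists_eq_pow_of_pow_three_eq_one hε (a := -x / y) (by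
        field_simp
        linear_combination -hxy)
      refine ⟨j, ?_⟩
      rw [← hj]
      field_simp
    have hne : ∀ x y : ℂ, x ^ 3 + y ^ 3 = 0 → y = 0 → x = 0 := by
      rintro x y hxy rfl
      simpa using hxy
    have hv' : ¬ (v 0 = 0 ∧ v 1 = 0 ∧ v 2 = 0) := by
      rintro ⟨h0, h1, h2⟩
      apply hv
      ext i
      fin_cases i <;> simp [h0, h1, h2]
    have done : ∀ (a : Fin 2 → ZMod 3) (c : ℂ), c • flexVec ε a = v →
        Projectivization.mk ℂ v hv ∈ Set.range (flexPoint ε) := fun a c h =>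
      ⟨a, ((Projectivization.mk_eq_mk_iff' ℂ _ _ _ _).2 ⟨c, h⟩).symm⟩
    rcases mul_eq_zero.1 hP with h | h2
    · rcases mul_eq_zero.1 h with h0 | h1
      · have hS' : v 1 ^ 3 + v 2 ^ 3 = 0 := by simpa [h0] using hS
        obtain ⟨j, hj⟩ := hroot _ _ hS' fun h => hv' ⟨h0, hne _ _ hS' h, h⟩
        refine done ![0, j] (v 2) ?_
        rw [flexVec_zero]
        ext i
        fin_cases i <;> simp [h0, hj]
      · have hS' : v 2 ^ 3 + v 0 ^ 3 = 0 := by simpa [h1, add_comm] using hS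
        obtain ⟨j, hj⟩ := hroot _ _ hS' fun h => hv' ⟨h, h1, hne _ _ hS' h⟩
        refine done ![1, j] (v 0) ?_
        rw [flexVec_one]
        ext i
        fin_cases i <;> simp [h1, hj]
    · have hS' : v 0 ^ 3 + v 1 ^ 3 = 0 := by simpa [h2] using hS
      obtain ⟨j, hj⟩ := hroot _ _ hS' fun h => hv' ⟨hne _ _ hS' h, h, h2⟩
      refine done ![2, j] (v 1) ?_
      rw [flexVec_two]
      ext i
      fin_cases i <;> simp [h2, hj]

lemma mem_range_flexPoint_iff_forall_curve (hε : IsPrimitiveRoot ε 3) {p : ℙ ℂ (Fin 3 → ℂ)} :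
    p ∈ Set.range (flexPoint ε) ↔ ∀ D ∈ hessePencil, p ∈ D := by
  induction p using Projectivization.ind with
  | _ v hv =>
    rw [mem_range_flexPoint_iff hε]
    constructor
    · rintro ⟨hS, hP⟩ _ ⟨α, β, -, rfl⟩
      rw [mk_mem_curve (hesseForm α β).2, eval_hesseForm, hS, hP]
      ring
    · intro h
      have h1 := h _ ⟨1, 0, hesseForm_ne_zero_iff.2 (by simp), rfl⟩
      have h2 := h _ ⟨0, 1, hesseForm_ne_zero_iff.2 (by simp), rfl⟩
      rw [mk_mem_curve (hesseForm _ _).2, eval_hesseForm] at h1 h2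
      exact ⟨by simpa only [one_mul, zero_mul, add_zero] using h1,
        by simpa only [one_mul, zero_mul, zero_add] using h2⟩

lemma flexes_eq_range (hε : IsPrimitiveRoot ε 3) {α β : ℂ}
    (h : α * (27 * α ^ 3 + β ^ 3) ≠ 0) :
    flexes (hesseForm α β : MvPolynomial (Fin 3) ℂ) = Set.range (flexPoint ε) := by
  ext p
  induction p using Projectivization.ind with
  | _ v hv =>
    rw [mem_range_flexPoint_iff hε, flexes, hessian_hesseForm, Set.mem_inter_iff,
      mk_mem_curve (hesseForm _ _).2, mk_mem_curve (hesseForm _ _).2, eval_hesseForm,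
      eval_hesseForm]
    constructor
    · rintro ⟨h1, h2⟩
      constructor
      · refine (mul_eq_zero.1 ?_).resolve_left h
        linear_combination ((216 * α ^ 3 + 2 * β ^ 3) * h1 - β * h2) / 8
      · refine (mul_eq_zero.1 ?_).resolve_left h
        linear_combination (α * h2 + 6 * α * β ^ 2 * h1) / 8
    · rintro ⟨hS, hP⟩
      rw [hS, hP]
      simp

/-- A cubic passing through the nine points belongs to the pencil. -/
lemma mem_hesseSpace_of_eval_flexVec (hε : IsPrimitiveRoot ε 3) {f : CubicForm}
    (h : ∀ a, MvPolynomial.eval (flexVec ε a) (f : MvPolynomial (Fin 3) ℂ) = 0) :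
    f ∈ hesseSpace := by
  obtain ⟨⟨c, d⟩, rfl⟩ := cubicOfCoeffs_surjective f
  rw [forall_label] at h
  obtain ⟨h0, h1, h2⟩ := h
  simp only [flexVec_zero, flexVec_one, flexVec_two, eval_cubicOfCoeffs, Fin.sum_univ_three,
    Matrix.cons_val_zero, Matrix.cons_val_one, Matrix.cons_val] at h0 h1 h2
  obtain ⟨e0, e0', e0''⟩ := quadratic_eq_zero hε (p := c 2 2 - c 1 1) (q := - c 2 1)
    (r := c 1 2) fun j => by linear_combination h0 j + c 1 1 * pow_val_pow_three hε j
  obtain ⟨e1, e1', e1''⟩ := quadratic_eq_zero hε (p := c 0 0 - c 2 2) (q := - c 0 2)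
    (r := c 2 0) fun j => by linear_combination h1 j + c 2 2 * pow_val_pow_three hε j
  obtain ⟨e2, e2', e2''⟩ := quadratic_eq_zero hε (p := c 1 1 - c 0 0) (q := - c 1 0)
    (r := c 0 1) fun j => by linear_combination h2 j + c 0 0 * pow_val_pow_three hε j
  refine mem_hesseSpace.2 ⟨c 0 0, d, cubicForm_ext fun v => ?_⟩
  rw [eval_hesseForm, eval_cubicOfCoeffs]
  simp only [Fin.sum_univ_three]
  linear_combination v 2 ^ 3 * (-e1) + v 1 ^ 3 * e2 - v 2 ^ 2 * v 1 * e0' + v 1 ^ 2 * v 2 * e0''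
    - v 0 ^ 2 * v 2 * e1' + v 2 ^ 2 * v 0 * e1'' - v 1 ^ 2 * v 0 * e2' + v 0 ^ 2 * v 1 * e2''

lemma stable_of_flexPoint (hε : IsPrimitiveRoot ε 3) {g : SL(3, ℂ)}
    (h : ∀ a, (g : PSL(3, ℂ))⁻¹ • flexPoint ε a ∈ Set.range (flexPoint ε)) :
    ∀ f ∈ hesseSpace, g • f ∈ hesseSpace := by
  intro f hf
  refine mem_hesseSpace_of_eval_flexVec hε fun a => ?_
  obtain ⟨α, β, rfl⟩ := mem_hesseSpace.1 hf
  have ha : (g⁻¹ : SL(3, ℂ)) • flexPoint ε a ∈ Set.range (flexPoint ε) := h a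
  rw [flexPoint, Projectivization.smul_mk, mem_range_flexPoint_iff hε, sl_smul_eq_mulVec] at ha
  rw [coe_smul, eval_subst, eval_hesseForm, ha.1, ha.2]
  ring

lemma smul_flexPoint_mem_of_mem_Hes (hε : IsPrimitiveRoot ε 3) {g : PSL(3, ℂ)} (hg : g ∈ Hes)
    (a : Fin 2 → ZMod 3) : g • flexPoint ε a ∈ Set.range (flexPoint ε) := by
  rw [mem_range_flexPoint_iff_forall_curve hε]
  intro D hD
  rw [← MulAction.mem_stabilizer_iff.1 hg] at hD
  obtain ⟨D', hD', rfl⟩ := hD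
  exact Set.smul_mem_smul_set
    ((mem_range_flexPoint_iff_forall_curve hε).1 (Set.mem_range_self a) D' hD')

lemma normalizer_hessePencil (hε : IsPrimitiveRoot ε 3) :
    normalizer PSL(3, ℂ) hessePencil = (Hes : Set PSL(3, ℂ)) := by
  ext g
  induction g using QuotientGroup.induction_on with
  | _ g =>
    constructor
    · intro hg
      refine mk_mem_Hes_of_stable (stable_of_flexPoint hε fun a => ?_)
      rw [mem_range_flexPoint_iff_forall_curve hε]
      intro D hD
      rw [← Set.mem_smul_set_iff_inv_smul_mem]
      exact (mem_range_flexPoint_iff_forall_curve hε).1 (Set.mem_range_self a) _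
        (hg (Set.smul_mem_smul_set hD))
    · intro hg
      exact (MulAction.mem_stabilizer_iff.1 hg).le

lemma normalizer_hesseLine (hε : IsPrimitiveRoot ε 3) :
    normalizer PSL(3, ℂ) hesseLine = (Hes : Set PSL(3, ℂ)) := by
  ext g
  induction g using QuotientGroup.induction_on with
  | _ g =>
    constructor
    · intro hg
      exact mk_mem_Hes_of_stable (mk_mem_normalizer_hesseLine.1 hg)
    · intro hg
      exact mk_mem_normalizer_hesseLine.2 (stable_of_flexPoint hε fun a =>
        smul_flexPoint_mem_of_mem_Hes hε (Hes.inv_mem hg) a)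

end

/-! ### Density of the orbit of the Hesse pencil -/

/-- The substitution `f ↦ f (A ·)` on cubic forms, for an arbitrary matrix `A`. -/
noncomputable def substForm (A : Matrix (Fin 3) (Fin 3) ℂ) (f : CubicForm) : CubicForm :=
  ⟨subst A f.1, subst_isHomogeneous A f.2⟩

lemma eval_substForm (A : Matrix (Fin 3) (Fin 3) ℂ) (f : CubicForm) (v : Fin 3 → ℂ) :
    MvPolynomial.eval v (substForm A f : MvPolynomial (Fin 3) ℂ) =
      MvPolynomial.eval (A.mulVec v) (f : MvPolynomial (Fin 3) ℂ) :=
  eval_subst A _ v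

lemma exists_smul_matrix_eq {A : Matrix (Fin 3) (Fin 3) ℂ} (hA : A.det ≠ 0) :
    ∃ (g : SL(3, ℂ)) (c : ℂ), c ≠ 0 ∧ A = c • g.1 := by
  obtain ⟨c, hc⟩ := IsAlgClosed.exists_pow_nat_eq A.det (n := 3) (by norm_num)
  have hc0 : c ≠ 0 := by
    rintro rfl
    exact hA (by rw [← hc]; norm_num)
  refine ⟨⟨c⁻¹ • A, ?_⟩, c, hc0, ?_⟩
  · rw [Matrix.det_smul, Fintype.card_fin, ← hc, ← mul_pow, inv_mul_cancel₀ hc0, one_pow]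
  · simp [smul_smul, hc0]

lemma exists_substForm_eq_smul {A : Matrix (Fin 3) (Fin 3) ℂ} (hA : A.det ≠ 0) :
    ∃ (g : SL(3, ℂ)) (c : ℂ), ∀ f : CubicForm, substForm A f = c • (g • f) := by
  obtain ⟨g, c, -, rfl⟩ := exists_smul_matrix_eq hA
  refine ⟨g⁻¹, c ^ 3, fun f => cubicForm_ext fun v => ?_⟩
  rw [Submodule.coe_smul, MvPolynomial.smul_eval, coe_smul, inv_inv, eval_subst, eval_substForm,
    Matrix.smul_mulVec, eval_smul_of_isHomogeneous f.2]

/-- The coefficients, in the sense of `cubicOfCoeffs`, of the cubic obtained from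
`x₀³ + x₁³ + x₂³ + b * x₀ x₁ x₂` by the substitution `A`; the argument is the pair `(A, b)`. -/
def orbitMap (p : (Fin 3 → Fin 3 → ℂ) × ℂ) : (Fin 3 → Fin 3 → ℂ) × ℂ :=
  (fun j k => if j = k then p.1 0 j ^ 3 + p.1 1 j ^ 3 + p.1 2 j ^ 3
        + p.2 * (p.1 0 j * p.1 1 j * p.1 2 j)
      else 3 * (p.1 0 j ^ 2 * p.1 0 k + p.1 1 j ^ 2 * p.1 1 k + p.1 2 j ^ 2 * p.1 2 k)
        + p.2 * (p.1 0 j * p.1 1 j * p.1 2 k + p.1 0 j * p.1 1 k * p.1 2 j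
          + p.1 0 k * p.1 1 j * p.1 2 j),
    6 * (p.1 0 0 * p.1 0 1 * p.1 0 2 + p.1 1 0 * p.1 1 1 * p.1 1 2 + p.1 2 0 * p.1 2 1 * p.1 2 2)
      + p.2 * (p.1 0 0 * p.1 1 1 * p.1 2 2 + p.1 0 0 * p.1 1 2 * p.1 2 1
        + p.1 0 1 * p.1 1 0 * p.1 2 2 + p.1 0 1 * p.1 1 2 * p.1 2 0
        + p.1 0 2 * p.1 1 0 * p.1 2 1 + p.1 0 2 * p.1 1 1 * p.1 2 0))

lemma cubicOfCoeffs_orbitMap (p : (Fin 3 → Fin 3 → ℂ) × ℂ) :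
    cubicOfCoeffs (orbitMap p) = substForm (Matrix.of p.1) (hesseForm 1 p.2) := by
  refine cubicForm_ext fun v => ?_
  rw [eval_cubicOfCoeffs, eval_substForm, eval_hesseForm]
  simp only [Fin.sum_univ_three, orbitMap, Matrix.mulVec, dotProduct, Matrix.of_apply]
  simp
  ring

lemma contDiff_orbitMap : ContDiff ℂ 1 orbitMap := by
  refine ContDiff.prodMk (contDiff_pi.2 fun j => contDiff_pi.2 fun k => ?_) (by fun_prop)
  by_cases h : j = k
  · simp only [h, if_true]
    fun_prop
  · simp only [h, if_false]
    fun_prop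

/-- At the identity matrix and `b = 0`, the differential of `orbitMap` is the bijection
`(B, b) ↦ (3 B, b)`: the tangent vectors `x_i² x_j` to the orbit of the Fermat cubic and the
direction `x₀ x₁ x₂` of the pencil span the space of all cubics. -/
lemma fderiv_orbitMap (z : (Fin 3 → Fin 3 → ℂ) × ℂ) :
    fderiv ℂ orbitMap ((1 : Matrix (Fin 3) (Fin 3) ℂ), 0) z = ((3 : ℂ) • z.1, z.2) := by
  set p₀ : (Fin 3 → Fin 3 → ℂ) × ℂ := ((1 : Matrix (Fin 3) (Fin 3) ℂ), 0) with hp₀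
  have hd : HasFDerivAt orbitMap (fderiv ℂ orbitMap p₀) p₀ :=
    (contDiff_orbitMap.differentiable (by norm_num) p₀).hasFDerivAt
  have hl : HasDerivAt (fun t : ℂ => p₀ + t • z) z 0 := by
    simpa using ((hasDerivAt_id (0 : ℂ)).smul_const z).const_add p₀
  have h1 : HasDerivAt (fun t : ℂ => orbitMap (p₀ + t • z)) (fderiv ℂ orbitMap p₀ z) 0 :=
    HasFDerivAt.comp_hasDerivAt (l := orbitMap) (l' := fderiv ℂ orbitMap p₀) (0 : ℂ)
      (f := fun t : ℂ => p₀ + t • z) (by simpa using hd) hl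
  refine h1.unique ?_
  have hA : ∀ i j, HasDerivAt (fun t : ℂ => (p₀ + t • z).1 i j) (z.1 i j) 0 := fun i j => by
    have := ((hasDerivAt_id (0 : ℂ)).mul_const (z.1 i j)).const_add (p₀.1 i j)
    simpa using this
  have hb : HasDerivAt (fun t : ℂ => (p₀ + t • z).2) z.2 0 := by
    simpa using ((hasDerivAt_id (0 : ℂ)).mul_const z.2).const_add p₀.2
  have hprod : ∀ i j k l m n, HasDerivAt
      (fun t : ℂ => (p₀ + t • z).1 i j * (p₀ + t • z).1 k l * (p₀ + t • z).1 m n)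
      ((z.1 i j * p₀.1 k l + p₀.1 i j * z.1 k l) * p₀.1 m n + p₀.1 i j * p₀.1 k l * z.1 m n) 0 :=
    fun i j k l m n => (((hA i j).mul (hA k l)).mul (hA m n)).congr_deriv (by simp)
  have hv : ∀ i j, p₀.1 i j = if i = j then 1 else 0 := fun i j => by
    simp [hp₀, Matrix.one_apply]
  have hv2 : p₀.2 = 0 := rfl
  refine HasDerivAt.prodMk (hasDerivAt_pi.2 fun j => hasDerivAt_pi.2 fun k => ?_) ?_
  · by_cases h : j = k
    · subst h
      simp only [if_true]
      refine (((((hA 0 j).pow 3).add ((hA 1 j).pow 3)).add ((hA 2 j).pow 3)).add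
        (hb.mul (hprod 0 j 1 j 2 j))).congr_deriv ?_
      fin_cases j <;> simp [hv, hv2]
    · simp only [h, if_false]
      refine (((((((hA 0 j).pow 2).mul (hA 0 k)).add (((hA 1 j).pow 2).mul (hA 1 k))).add
        (((hA 2 j).pow 2).mul (hA 2 k))).const_mul 3).add (hb.mul
        (((hprod 0 j 1 j 2 k).add (hprod 0 j 1 k 2 j)).add (hprod 0 k 1 j 2 j)))).congr_deriv ?_
      fin_cases j <;> fin_cases k <;> simp [hv, hv2] at h ⊢
  · refine (((((hprod 0 0 0 1 0 2).add (hprod 1 0 1 1 1 2)).add (hprod 2 0 2 1 2 2)).const_mul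
      6).add (hb.mul ((((((hprod 0 0 1 1 2 2).add (hprod 0 0 1 2 2 1)).add
      (hprod 0 1 1 0 2 2)).add (hprod 0 1 1 2 2 0)).add (hprod 0 2 1 0 2 1)).add
      (hprod 0 2 1 1 2 0)))).congr_deriv ?_
    simp [hv, hv2]

/-- By the inverse function theorem, the cubics equivalent to a member of the pencil fill a
neighbourhood of the Fermat cubic; hence a polynomial vanishing on them is zero. -/
lemma evalDual_eq_zero_of_forall_smul {P : MvPolynomial (Module.Dual ℂ CubicForm) ℂ} {n : ℕ}
    (hP : P.IsHomogeneous n)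
    (h : ∀ (g : SL(3, ℂ)), ∀ f ∈ hesseSpace, f ≠ 0 → evalDual P (g • f) = 0) (w : CubicForm) :
    evalDual P w = 0 := by
  set p₀ : (Fin 3 → Fin 3 → ℂ) × ℂ := ((1 : Matrix (Fin 3) (Fin 3) ℂ), 0) with hp₀
  have hsurj : (fderiv ℂ orbitMap p₀).range = ⊤ := by
    rw [LinearMap.range_eq_top]
    intro y
    refine ⟨((3 : ℂ)⁻¹ • y.1, y.2), ?_⟩
    refine (fderiv_orbitMap _).trans ?_
    simp [smul_smul]
  have hmap := ((contDiff_orbitMap.contDiffAt (x := p₀)).hasStrictFDerivAt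
    (by norm_num)).map_nhds_eq_of_surj hsurj
  have hdet : ∀ᶠ p in nhds p₀, (Matrix.of p.1).det ≠ 0 := by
    have hc : Continuous fun p : (Fin 3 → Fin 3 → ℂ) × ℂ => (Matrix.of p.1).det :=
      Continuous.matrix_det (by exact continuous_fst)
    refine hc.continuousAt.eventually_ne ?_
    change (1 : Matrix (Fin 3) (Fin 3) ℂ).det ≠ 0
    simp
  have hnear : ∀ᶠ c in nhds (orbitMap p₀), evalDual P (cubicOfCoeffs c) = 0 := by
    rw [← hmap, Filter.eventually_map]
    filter_upwards [hdet] with p hp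
    obtain ⟨g, c, hgc⟩ := exists_substForm_eq_smul hp
    rw [cubicOfCoeffs_orbitMap, hgc, evalDual_smul hP,
      h g _ (hesseForm_mem _ _) (hesseForm_ne_zero_iff.2 (by simp)), mul_zero]
  refine evalDual_eq_zero_of_lines (u := cubicOfCoeffs (orbitMap p₀)) (fun v => ?_) w
  obtain ⟨c, rfl⟩ := cubicOfCoeffs_surjective v
  have hcont : Filter.Tendsto (fun t : ℂ => orbitMap p₀ + t • c) (nhds 0)
      (nhds (orbitMap p₀)) := by
    have : Continuous fun t : ℂ => orbitMap p₀ + t • c := by fun_prop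
    simpa using this.tendsto 0
  refine infinite_of_mem_nhds (0 : ℂ) ?_
  filter_upwards [hcont.eventually hnear] with t ht
  rwa [map_add, map_smul] at ht

lemma closure_univ_smul_hesseLine :
    closure ((Set.univ : Set PSL(3, ℂ)) • hesseLine) = Set.univ := by
  obtain ⟨T, hT, hTc⟩ := isClosed_iff_isZariskiClosed.1
    (isClosed_closure (s := (Set.univ : Set PSL(3, ℂ)) • hesseLine))
  rw [hTc, Set.eq_univ_iff_forall]
  intro x P hPT
  obtain ⟨n, hP⟩ := hT P hPT
  refine evalDual_eq_zero_of_forall_smul hP (fun g f hf hf0 => ?_) _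
  have hmem : (g : PSL(3, ℂ)) • Projectivization.mk ℂ f hf0 ∈ projZeroLocus T := by
    rw [← hTc]
    exact subset_closure (Set.smul_mem_smul (Set.mem_univ _) ((mk_mem_hesseLine hf0).2 hf))
  have := hmem P hPT
  rwa [psl_smul, Projectivization.smul_mk, evalDual_rep_mk hP] at this

/-! ### The Hesse pencil as a relative section -/

/-- The coefficient of the monomial with exponents `d`, as a linear form on cubic forms. -/
noncomputable def coeffDual (d : Fin 3 →₀ ℕ) : Module.Dual ℂ CubicForm :=
  (MvPolynomial.lcoeff ℂ d).comp (Submodule.subtype _)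

/-- A quartic form on `U` restricting to `α (27 α³ + β³)` on the Hesse pencil. -/
noncomputable def pencilDiscr : MvPolynomial (Module.Dual ℂ CubicForm) ℂ :=
  let a := MvPolynomial.X (coeffDual (Finsupp.single 0 3))
  let b := MvPolynomial.X (coeffDual (Finsupp.single 0 1 + Finsupp.single 1 1 + Finsupp.single 2 1))
  a * (MvPolynomial.C 27 * a ^ 3 + b ^ 3)

lemma isHomogeneous_pencilDiscr : pencilDiscr.IsHomogeneous 4 := by
  have h (φ : Module.Dual ℂ CubicForm) :
      (MvPolynomial.X φ ^ 3 : MvPolynomial (Module.Dual ℂ CubicForm) ℂ).IsHomogeneous 3 := by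
    simpa using (MvPolynomial.isHomogeneous_X ℂ φ).pow 3
  exact (MvPolynomial.isHomogeneous_X ℂ _).mul (((h _).C_mul 27).add (h _))

lemma evalDual_pencilDiscr (α β : ℂ) :
    evalDual pencilDiscr (hesseForm α β) = α * (27 * α ^ 3 + β ^ 3) := by
  have hX (i : Fin 3) : (MvPolynomial.X i ^ 3 : MvPolynomial (Fin 3) ℂ) =
      MvPolynomial.monomial (Finsupp.single i 3) 1 := MvPolynomial.X_pow_eq_monomial
  have hXXX : (MvPolynomial.X 0 * MvPolynomial.X 1 * MvPolynomial.X 2 : MvPolynomial (Fin 3) ℂ) =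
      MvPolynomial.monomial (Finsupp.single 0 1 + Finsupp.single 1 1 + Finsupp.single 2 1) 1 := by
    simp [MvPolynomial.X, MvPolynomial.monomial_mul]
  have ha : coeffDual (Finsupp.single 0 3) (hesseForm α β) = α := by
    change MvPolynomial.coeff _ (hesseForm α β : MvPolynomial (Fin 3) ℂ) = α
    rw [coe_hesseForm, hX, hX, hX, hXXX]
    simp [MvPolynomial.coeff_monomial, Finsupp.ext_iff, Fin.forall_fin_succ, Finsupp.single_apply]
  have hb : coeffDual (Finsupp.single 0 1 + Finsupp.single 1 1 + Finsupp.single 2 1)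
      (hesseForm α β) = β := by
    change MvPolynomial.coeff _ (hesseForm α β : MvPolynomial (Fin 3) ℂ) = β
    rw [coe_hesseForm, hX, hX, hX, hXXX]
    simp [MvPolynomial.coeff_monomial, Finsupp.ext_iff, Fin.forall_fin_succ, Finsupp.single_apply]
  simp [evalDual, pencilDiscr, ha, hb]

lemma isRelativeSection_hesseLine : IsRelativeSection PSL(3, ℂ) hesseLine := by
  have hx₀ : hesseForm 1 0 ≠ 0 := hesseForm_ne_zero_iff.2 (by simp)
  have hirr : IsIrreducible hesseLine := by
    refine ⟨⟨_, (mk_mem_hesseLine hx₀).2 (hesseForm_mem 1 0)⟩, ?_⟩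
    rw [hesseLine_eq_projSubspace]
    exact isPreirreducible_projSubspace _
  have : IrreducibleSpace hesseLine := Subtype.irreducibleSpace hirr
  refine ⟨?_, ?_, ?_⟩
  · rw [hesseLine_eq_projSubspace]
    exact isClosed_projSubspace _
  · intro Z hZ
    rw [irreducibleComponents_eq_singleton, Set.mem_singleton_iff] at hZ
    rw [hZ, Set.image_univ, Subtype.range_coe]
    exact closure_univ_smul_hesseLine
  · have hopen : IsOpen {x : ℙ ℂ CubicForm | evalDual pencilDiscr x.rep ≠ 0} := by
      rw [← isClosed_compl_iff, isClosed_iff_isZariskiClosed]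
      refine ⟨{pencilDiscr}, ?_, ?_⟩
      · rintro _ rfl
        exact ⟨4, isHomogeneous_pencilDiscr⟩
      · ext x
        simp [projZeroLocus]
    have hopen' : IsOpen {x : hesseLine | evalDual pencilDiscr x.1.rep ≠ 0} :=
      hopen.preimage continuous_subtype_val
    refine ⟨_, hopen', hopen'.dense ?_, ?_⟩
    · refine ⟨⟨_, (mk_mem_hesseLine hx₀).2 (hesseForm_mem 1 0)⟩, ?_⟩
      change evalDual _ _ ≠ 0
      rw [Ne, evalDual_rep_mk isHomogeneous_pencilDiscr, evalDual_pencilDiscr]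
      norm_num
    · intro r
      induction r using QuotientGroup.induction_on with
      | _ g =>
        rintro ⟨_, ⟨_, ⟨⟨_, ⟨α, β, h0, rfl⟩⟩, hD, rfl⟩, rfl⟩, ⟨y, -, hy⟩⟩
        refine mk_mem_normalizer_hesseLine.2 (stable_of_smul_hesseForm_mem (α := α) (β := β) ?_ ?_)
        · change evalDual _ _ ≠ 0 at hD
          rwa [Ne, evalDual_rep_mk isHomogeneous_pencilDiscr, evalDual_pencilDiscr] at hD
        · have hy' := y.2
          rw [hy] at hy'
          exact (mk_mem_hesseLine (smul_ne_zero_of_form g h0)).1 hy'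

/-! ### Unimodular affine transformations of the labels -/

lemma mem_SAff_iff {s : (Fin 2 → ZMod 3) ≃ᵃ[ZMod 3] (Fin 2 → ZMod 3)} :
    s ∈ SAff (ZMod 3) (Fin 2 → ZMod 3) ↔
      LinearMap.det (s.linear : (Fin 2 → ZMod 3) →ₗ[ZMod 3] (Fin 2 → ZMod 3)) = 1 := by
  rw [← LinearEquiv.coe_det]
  exact (Units.val_eq_one (a := LinearEquiv.det s.linear)).symm

lemma constVAdd_mem_SAff (v : Fin 2 → ZMod 3) :
    AffineEquiv.constVAdd (ZMod 3) (Fin 2 → ZMod 3) v ∈ SAff (ZMod 3) (Fin 2 → ZMod 3) := by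
  rw [mem_SAff_iff]
  exact LinearMap.det_id

lemma affineEquiv_mul_apply (s t : (Fin 2 → ZMod 3) ≃ᵃ[ZMod 3] (Fin 2 → ZMod 3))
    (a : Fin 2 → ZMod 3) : (s * t) a = s (t a) := rfl

/-- The linear transformation with matrix `M`, as an affine transformation. -/
def slAffine (M : SL(2, ZMod 3)) : (Fin 2 → ZMod 3) ≃ᵃ[ZMod 3] (Fin 2 → ZMod 3) :=
  (Matrix.SpecialLinearGroup.toLin' M).toAffineEquiv

lemma slAffine_mem_SAff (M : SL(2, ZMod 3)) :
    slAffine M ∈ SAff (ZMod 3) (Fin 2 → ZMod 3) := by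
  rw [mem_SAff_iff]
  change LinearMap.det (Matrix.toLin' M.1) = 1
  rw [LinearMap.det_toLin', M.2]

lemma slAffine_apply (M : SL(2, ZMod 3)) (a : Fin 2 → ZMod 3) : slAffine M a = M.1.mulVec a := rfl

/-- The shear `(i, j) ↦ (i, j - k i)`. -/
def shear (k : ZMod 3) : SL(2, ZMod 3) := ⟨!![1, 0; -k, 1], by simp [Matrix.det_fin_two]⟩

/-- The rotation `(i, j) ↦ (j, -i)`. -/
def rotation : SL(2, ZMod 3) := ⟨!![0, 1; -1, 0], by simp [Matrix.det_fin_two]⟩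

lemma slAffine_shear (k i j : ZMod 3) : slAffine (shear k) ![i, j] = ![i, j - k * i] := by
  rw [slAffine_apply]
  refine fin_two_zmod_ext ?_ ?_ <;> simp [shear, Matrix.mulVec, dotProduct]
  ring

lemma slAffine_rotation (i j : ZMod 3) : slAffine rotation ![i, j] = ![j, -i] := by
  rw [slAffine_apply]
  refine fin_two_zmod_ext ?_ ?_ <;> simp [rotation, Matrix.mulVec, dotProduct]

lemma label_zero : (![0, 0] : Fin 2 → ZMod 3) = 0 := by simp

/-- A unimodular affine transformation fixing two labels of a line through the origin is a shear. -/
lemma eq_shear_of_mem_SAff {s : (Fin 2 → ZMod 3) ≃ᵃ[ZMod 3] (Fin 2 → ZMod 3)}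
    (hs : s ∈ SAff (ZMod 3) (Fin 2 → ZMod 3)) (h0 : s ![0, 0] = ![0, 0])
    (h1 : s ![0, 1] = ![0, 1]) : ∃ k, s = slAffine (shear k) := by
  rw [label_zero] at h0
  have hlin : ∀ a, s a = s.linear a := fun a => by
    have := s.map_vadd 0 a
    simpa [h0] using this
  rw [hlin] at h1
  set f : (Fin 2 → ZMod 3) →ₗ[ZMod 3] (Fin 2 → ZMod 3) := s.linear.toLinearMap with hf
  have hdet := mem_SAff_iff.1 hs
  rw [← hf, ← LinearMap.det_toMatrix', Matrix.det_fin_two] at hdet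
  have e0 : (Pi.single 0 1 : Fin 2 → ZMod 3) = ![1, 0] := by decide
  have e1 : (Pi.single 1 1 : Fin 2 → ZMod 3) = ![0, 1] := by decide
  have hf1 : f ![0, 1] = ![0, 1] := h1
  simp only [LinearMap.toMatrix'_apply] at hdet
  have hdet' : f ![1, 0] 0 = 1 := by simpa [e0, e1, hf1] using hdet
  refine ⟨-(f ![1, 0] 1), AffineEquiv.ext fun a => ?_⟩
  have ha : a = a 0 • ![1, 0] + a 1 • ![0, 1] := by
    refine fin_two_zmod_ext ?_ ?_ <;> simp
  have hsa : s a = a 0 • f ![1, 0] + a 1 • ![0, 1] := by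
    rw [hlin]
    change f a = _
    conv_lhs => rw [ha]
    rw [map_add, map_smul, map_smul, hf1]
  have ha' : a = ![a 0, a 1] := fin_two_zmod_ext rfl rfl
  rw [hsa]
  conv_rhs => rw [ha', slAffine_shear]
  refine fin_two_zmod_ext ?_ ?_
  · simp [hdet']
  · simp
    ring

/-! ### The action of the Hessian group on the labels -/

section

variable {ε : ℂ}

/-- The projective transformation `g` permutes the nine points, acting on their labels by `s`. -/
def ActsOnLabels (ε : ℂ) (g : PSL(3, ℂ)) (s : (Fin 2 → ZMod 3) ≃ᵃ[ZMod 3] (Fin 2 → ZMod 3)) :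
    Prop :=
  ∀ a, g • flexPoint ε a = flexPoint ε (s a)

lemma ActsOnLabels.mul {g g' : PSL(3, ℂ)} {s s' : (Fin 2 → ZMod 3) ≃ᵃ[ZMod 3] (Fin 2 → ZMod 3)}
    (h : ActsOnLabels ε g s) (h' : ActsOnLabels ε g' s') : ActsOnLabels ε (g * g') (s * s') :=
  fun a => by rw [mul_smul, h' a, h (s' a), affineEquiv_mul_apply]

lemma ActsOnLabels.inv {g : PSL(3, ℂ)} {s : (Fin 2 → ZMod 3) ≃ᵃ[ZMod 3] (Fin 2 → ZMod 3)}
    (h : ActsOnLabels ε g s) : ActsOnLabels ε g⁻¹ s⁻¹ := fun a => by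
  rw [inv_smul_eq_iff, h, ← affineEquiv_mul_apply, mul_inv_cancel, AffineEquiv.coe_one, id]

lemma ActsOnLabels.mem_Hes (hε : IsPrimitiveRoot ε 3) {g : PSL(3, ℂ)}
    {s : (Fin 2 → ZMod 3) ≃ᵃ[ZMod 3] (Fin 2 → ZMod 3)} (h : ActsOnLabels ε g s) : g ∈ Hes := by
  induction g using QuotientGroup.induction_on with
  | _ g => exact mk_mem_Hes_of_stable (stable_of_flexPoint hε fun a => ⟨_, (h.inv a).symm⟩)

lemma ActsOnLabels.unique (hε : IsPrimitiveRoot ε 3) {g : PSL(3, ℂ)}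
    {s s' : (Fin 2 → ZMod 3) ≃ᵃ[ZMod 3] (Fin 2 → ZMod 3)}
    (h : ActsOnLabels ε g s) (h' : ActsOnLabels ε g s') : s = s' :=
  AffineEquiv.ext fun a => flexPoint_injective hε ((h a).symm.trans (h' a))

lemma actsOnLabels_of_matrix {A : Matrix (Fin 3) (Fin 3) ℂ}
    {s : (Fin 2 → ZMod 3) ≃ᵃ[ZMod 3] (Fin 2 → ZMod 3)}
    (h : ∀ a, ∃ c : ℂ, A.mulVec (flexVec ε a) = c • flexVec ε (s a)) {g : SL(3, ℂ)} {c : ℂ}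
    (hg : g.1 = c • A) : ActsOnLabels ε g s := by
  intro a
  change g • Projectivization.mk ℂ (flexVec ε a) (flexVec_ne_zero ε a) =
    Projectivization.mk ℂ (flexVec ε (s a)) (flexVec_ne_zero ε (s a))
  rw [Projectivization.smul_mk, Projectivization.mk_eq_mk_iff']
  obtain ⟨c', hc'⟩ := h a
  refine ⟨c * c', ?_⟩
  rw [sl_smul_eq_mulVec, hg, Matrix.smul_mulVec, hc', smul_smul]

/-- The subgroup of unimodular affine transformations induced by projective transformations
permuting the nine points. -/
def realizable (ε : ℂ) : Subgroup ((Fin 2 → ZMod 3) ≃ᵃ[ZMod 3] (Fin 2 → ZMod 3)) where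
  carrier := {s | s ∈ SAff (ZMod 3) (Fin 2 → ZMod 3) ∧ ∃ g, ActsOnLabels ε g s}
  one_mem' := ⟨one_mem _, 1, fun _ => one_smul _ _⟩
  mul_mem' := fun ⟨h, g, hg⟩ ⟨h', g', hg'⟩ => ⟨mul_mem h h', g * g', hg.mul hg'⟩
  inv_mem' := fun ⟨h, g, hg⟩ => ⟨inv_mem h, g⁻¹, hg.inv⟩

lemma mem_realizable_of_matrix {s : (Fin 2 → ZMod 3) ≃ᵃ[ZMod 3] (Fin 2 → ZMod 3)}
    (hs : s ∈ SAff (ZMod 3) (Fin 2 → ZMod 3)) {A : Matrix (Fin 3) (Fin 3) ℂ} (hA : A.det ≠ 0)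
    (h : ∀ a, ∃ c : ℂ, A.mulVec (flexVec ε a) = c • flexVec ε (s a)) : s ∈ realizable ε := by
  obtain ⟨g, c, hc, hgA⟩ := exists_smul_matrix_eq hA
  refine ⟨hs, g, actsOnLabels_of_matrix h (c := c⁻¹) ?_⟩
  rw [hgA, smul_smul, inv_mul_cancel₀ hc, one_smul]

lemma pow_val_add (hε : IsPrimitiveRoot ε 3) (j k : ZMod 3) :
    ε ^ (j + k).val = ε ^ j.val * ε ^ k.val := by
  rw [ZMod.val_add, ← pow_add, pow_eq_pow_mod (j.val + k.val) hε.pow_eq_one]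

lemma pow_val_neg (hε : IsPrimitiveRoot ε 3) (j : ZMod 3) : ε ^ (-j).val = (ε ^ j.val) ^ 2 := by
  have hj : -j = j + j := by
    revert j
    decide
  rw [hj, pow_val_add hε, sq]

/-- The matrix `diag(ε^k, 1, 1)` induces the shear with parameter `k`. -/
lemma exists_diagonal_mulVec_flexVec (hε : IsPrimitiveRoot ε 3) (k : ZMod 3) :
    ∀ a, ∃ c : ℂ, (Matrix.diagonal ![ε ^ k.val, 1, 1]).mulVec (flexVec ε a) =
      c • flexVec ε (slAffine (shear k) a) := by
  have h3 := pow_val_pow_three hε k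
  rw [forall_label]
  refine ⟨fun j => ⟨1, ?_⟩, fun j => ⟨ε ^ k.val, ?_⟩, fun j => ⟨1, ?_⟩⟩
  · rw [slAffine_shear, mul_zero, sub_zero, flexVec_zero]
    ext i
    fin_cases i <;> simp [Matrix.mulVec_diagonal]
  · rw [slAffine_shear, mul_one, flexVec_one, flexVec_one, sub_eq_add_neg, pow_val_add hε,
      pow_val_neg hε]
    ext i
    fin_cases i <;> simp [Matrix.mulVec_diagonal]
    linear_combination -ε ^ j.val * h3
  · have hk : j - k * 2 = j + k := by
      have : (3 : ZMod 3) = 0 := rfl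
      linear_combination -k * this
    rw [slAffine_shear, hk, flexVec_two, flexVec_two, pow_val_add hε]
    ext i
    fin_cases i <;> simp [Matrix.mulVec_diagonal, mul_comm]

lemma shear_mem_realizable (hε : IsPrimitiveRoot ε 3) (k : ZMod 3) :
    slAffine (shear k) ∈ realizable ε := by
  refine mem_realizable_of_matrix (slAffine_mem_SAff _) ?_ (exists_diagonal_mulVec_flexVec hε k)
  simp [Matrix.det_diagonal, Fin.prod_univ_three, hε.ne_zero]

/-- The discrete Fourier transform `(ε^{ij})` induces the rotation `(i, j) ↦ (j, -i)`. -/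
lemma rotation_mem_realizable (hε : IsPrimitiveRoot ε 3) :
    slAffine rotation ∈ realizable ε := by
  have h2 := sq_add_self_add_one hε
  have hv1 : (1 : ZMod 3).val = 1 := rfl
  have hv2 : (2 : ZMod 3).val = 2 := rfl
  have hn1 : (-1 : ZMod 3) = 2 := rfl
  have hn2 : (-2 : ZMod 3) = 1 := rfl
  refine mem_realizable_of_matrix (slAffine_mem_SAff _)
    (A := !![1, 1, 1; 1, ε, ε ^ 2; 1, ε ^ 2, ε]) ?_ ?_
  · rw [Matrix.det_fin_three]
    simp
    intro h
    have h1 : ε ≠ 1 := hε.ne_one (by norm_num)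
    have h0 : ε ≠ 0 := hε.ne_zero (by norm_num)
    grind
  · have hall : ∀ j : ZMod 3, j = 0 ∨ j = 1 ∨ j = 2 := zmod_three_cases
    rw [forall_label]
    refine ⟨fun j => ?_, fun j => ?_, fun j => ?_⟩ <;> rw [slAffine_rotation] <;>
      rcases hall j with rfl | rfl | rfl <;>
      simp only [flexVec_zero, flexVec_one, flexVec_two, neg_zero, hn1, hn2, hv1, hv2,
        ZMod.val_zero, pow_zero, pow_one]
    on_goal 1 => refine ⟨ε - ε ^ 2, ?_⟩
    on_goal 2 => refine ⟨1 - ε, ?_⟩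
    on_goal 3 => refine ⟨ε ^ 2 - 1, ?_⟩
    on_goal 4 => refine ⟨1 - ε, ?_⟩
    on_goal 5 => refine ⟨1 - ε, ?_⟩
    on_goal 6 => refine ⟨1 - ε, ?_⟩
    on_goal 7 => refine ⟨ε ^ 2 - 1, ?_⟩
    on_goal 8 => refine ⟨1 - ε, ?_⟩
    on_goal 9 => refine ⟨ε - ε ^ 2, ?_⟩
    all_goals
      ext i
      fin_cases i <;> simp [Matrix.mulVec, dotProduct, Fin.sum_univ_three] <;> grind

/-- Translations are induced by products of powers of `diag(1, ε, ε²)` and of the cyclic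
permutation of the coordinates. -/
lemma translation_mem_realizable (hε : IsPrimitiveRoot ε 3) (v : Fin 2 → ZMod 3) :
    AffineEquiv.constVAdd (ZMod 3) (Fin 2 → ZMod 3) v ∈ realizable ε := by
  have h10 : AffineEquiv.constVAdd (ZMod 3) (Fin 2 → ZMod 3) ![1, 0] ∈ realizable ε := by
    refine mem_realizable_of_matrix (constVAdd_mem_SAff _)
      (A := !![0, 0, 1; 1, 0, 0; 0, 1, 0]) ?_ ?_
    · simp [Matrix.det_fin_three]
    · have h12 : (1 + 1 : ZMod 3) = 2 := rfl
      have h120 : (1 + 2 : ZMod 3) = 0 := rfl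
      rw [forall_label]
      refine ⟨fun j => ⟨1, ?_⟩, fun j => ⟨1, ?_⟩, fun j => ⟨1, ?_⟩⟩ <;>
        simp only [AffineEquiv.constVAdd_apply, vadd_eq_add, Matrix.cons_add_cons, zero_add,
          add_zero, h12, h120, flexVec_zero, flexVec_one, flexVec_two, Matrix.empty_add_empty] <;>
        ext i <;> fin_cases i <;> simp [Matrix.mulVec, dotProduct, Fin.sum_univ_three]
  have h01 : AffineEquiv.constVAdd (ZMod 3) (Fin 2 → ZMod 3) ![0, 1] ∈ realizable ε := by
    refine mem_realizable_of_matrix (constVAdd_mem_SAff _)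
      (A := Matrix.diagonal ![1, ε ^ 2, ε]) ?_ ?_
    · simp [Matrix.det_diagonal, Fin.prod_univ_three, hε.ne_zero]
    · have h3 := hε.pow_eq_one
      have hv1 : (1 : ZMod 3).val = 1 := rfl
      rw [forall_label]
      refine ⟨fun j => ⟨ε, ?_⟩, fun j => ⟨1, ?_⟩, fun j => ⟨ε ^ 2, ?_⟩⟩ <;>
        simp only [AffineEquiv.constVAdd_apply, vadd_eq_add, Matrix.cons_add_cons, zero_add,
          flexVec_zero, flexVec_one, flexVec_two, add_comm (1 : ZMod 3), pow_val_add hε, hv1,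
          pow_one, Matrix.empty_add_empty] <;>
        ext i <;> fin_cases i <;> simp [Matrix.mulVec_diagonal] <;> grind
  have hv : v = (v 0).val • ![1, 0] + (v 1).val • ![0, 1] := by
    refine fin_two_zmod_ext ?_ ?_ <;> simp
  rw [hv, AffineEquiv.constVAdd_add, AffineEquiv.constVAdd_nsmul, AffineEquiv.constVAdd_nsmul]
  exact mul_mem (pow_mem h10 _) (pow_mem h01 _)

/-- The realizable transformations are 2-transitive on the labels. -/
lemma exists_realizable_map_pair (hε : IsPrimitiveRoot ε 3) {a b : Fin 2 → ZMod 3} (hab : a ≠ b) :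
    ∃ s ∈ realizable ε, s a = ![0, 0] ∧ s b = ![0, 1] := by
  have hrot := rotation_mem_realizable hε
  have hfix : ∀ M : SL(2, ZMod 3), slAffine M ![0, 0] = ![0, 0] := fun M => by
    rw [label_zero, slAffine_apply, Matrix.mulVec_zero]
  have hvert : ∀ j : ZMod 3, j ≠ 0 →
      ∃ s ∈ realizable ε, s ![0, 0] = ![0, 0] ∧ s ![0, j] = ![0, 1] := by
    intro j hj
    rcases zmod_three_cases j with rfl | rfl | rfl
    · exact absurd rfl hj
    · exact ⟨1, one_mem _, rfl, rfl⟩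
    · refine ⟨slAffine rotation * slAffine rotation, mul_mem hrot hrot, ?_, ?_⟩
      · rw [affineEquiv_mul_apply, hfix, hfix]
      · rw [affineEquiv_mul_apply, slAffine_rotation, slAffine_rotation]
        decide
  have horigin : ∀ i j : ZMod 3, ![i, j] ≠ ![0, 0] →
      ∃ s ∈ realizable ε, s ![0, 0] = ![0, 0] ∧ s ![i, j] = ![0, 1] := by
    intro i j hij
    by_cases hi : i = 0
    · subst hi
      exact hvert j fun hj => hij (by rw [hj])
    · obtain ⟨s, hs, hs0, hs1⟩ := hvert (-i) (neg_ne_zero.2 hi)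
      have hk : j - i * j * i = 0 := by
        have hsq : ∀ i : ZMod 3, i ≠ 0 → i * i = 1 := by decide
        have := hsq i hi
        linear_combination -j * this
      refine ⟨s * slAffine rotation * slAffine (shear (i * j)),
        mul_mem (mul_mem hs hrot) (shear_mem_realizable hε _), ?_, ?_⟩
      · rw [affineEquiv_mul_apply, affineEquiv_mul_apply, hfix, hfix, hs0]
      · rw [affineEquiv_mul_apply, affineEquiv_mul_apply, slAffine_shear, hk, slAffine_rotation,
          hs1]
  have hba : b - a = ![(b - a) 0, (b - a) 1] := fin_two_zmod_ext rfl rfl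
  obtain ⟨s, hs, hs0, hs1⟩ := horigin ((b - a) 0) ((b - a) 1) (by
    rw [← hba]
    intro h
    exact hab (sub_eq_zero.1 (h.trans label_zero)).symm)
  refine ⟨s * AffineEquiv.constVAdd _ _ (-a), mul_mem hs (translation_mem_realizable hε _), ?_, ?_⟩
  · rw [affineEquiv_mul_apply, AffineEquiv.constVAdd_apply, vadd_eq_add, neg_add_cancel]
    rw [← label_zero, hs0]
  · rw [affineEquiv_mul_apply, AffineEquiv.constVAdd_apply, vadd_eq_add, neg_add_eq_sub, hba, hs1]

/-- A projective transformation permuting the nine points and fixing two of those on the line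
`x₀ = 0` fixes that line pointwise. The images of the points `(1 : 0 : -ε^j)` then force it to be
`diag(ε^k, 1, 1)`. -/
lemma exists_eq_smul_diagonal (hε : IsPrimitiveRoot ε 3) {g : SL(3, ℂ)}
    (hg : ∀ a, (g : PSL(3, ℂ)) • flexPoint ε a ∈ Set.range (flexPoint ε))
    (h0 : (g : PSL(3, ℂ)) • flexPoint ε ![0, 0] = flexPoint ε ![0, 0])
    (h1 : (g : PSL(3, ℂ)) • flexPoint ε ![0, 1] = flexPoint ε ![0, 1]) :
    ∃ (k : ZMod 3) (c : ℂ), g.1 = c • Matrix.diagonal ![ε ^ k.val, 1, 1] := by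
  have hε1 : ε ≠ 1 := hε.ne_one (by norm_num)
  have hmk : ∀ a b, (g : PSL(3, ℂ)) • flexPoint ε a = flexPoint ε b →
      ∃ c : ℂ, c • flexVec ε b = g.1.mulVec (flexVec ε a) := fun a b h =>
    (Projectivization.mk_eq_mk_iff' ℂ _ _ _ _).1 h
  have hzeros : ∀ a, (g.1.mulVec (flexVec ε a)) 0 ^ 3 + (g.1.mulVec (flexVec ε a)) 1 ^ 3 +
      (g.1.mulVec (flexVec ε a)) 2 ^ 3 = 0 ∧ (g.1.mulVec (flexVec ε a)) 0 *
      (g.1.mulVec (flexVec ε a)) 1 * (g.1.mulVec (flexVec ε a)) 2 = 0 := fun a => by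
    have := hg a
    change g • Projectivization.mk ℂ _ _ ∈ _ at this
    rwa [Projectivization.smul_mk, mem_range_flexPoint_iff hε] at this
  have hdet := g.2
  rw [Matrix.det_fin_three] at hdet
  -- the images of two points of the line `x₀ = 0` are on that line
  have hrow : g.1 0 1 = 0 ∧ g.1 0 2 = 0 := by
    obtain ⟨c, hc⟩ := hmk _ _ h0
    obtain ⟨d, hd⟩ := hmk _ _ h1
    have ec := congrFun hc 0
    have ed := congrFun hd 0
    simp [flexVec_zero, Matrix.mulVec, dotProduct, Fin.sum_univ_three, ZMod.val_one] at ec ed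
    have : g.1 0 1 * (1 - ε) = 0 := by linear_combination ec - ed
    have h01 := (mul_eq_zero.1 this).resolve_right (sub_ne_zero.2 hε1.symm)
    exact ⟨h01, by linear_combination -ec + h01⟩
  obtain ⟨h01, h02⟩ := hrow
  -- hence the third of the nine points on that line is fixed as well
  have hline : ∀ j : ZMod 3, (g : PSL(3, ℂ)) • flexPoint ε ![0, j] = flexPoint ε ![0, j] := by
    obtain ⟨b, hb⟩ := hg ![0, 2]
    obtain ⟨c, hc⟩ := hmk _ _ hb.symm
    have hc0 : c ≠ 0 := by
      rintro rfl
      rw [zero_smul] at hc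
      exact (smul_ne_zero_iff_ne g).2 (flexVec_ne_zero ε ![0, 2]) hc.symm
    have e0 := congrFun hc 0
    have hb0 : flexVec ε b 0 = 0 := by
      simpa [flexVec_zero, Matrix.mulVec, dotProduct, Fin.sum_univ_three, h01, h02, hc0] using e0
    have hb' : b 0 = 0 := by
      have hb' : b = ![b 0, b 1] := fin_two_zmod_ext rfl rfl
      rcases zmod_three_cases (b 0) with h | h | h
      · exact h
      · rw [hb', h, flexVec_one] at hb0
        simp at hb0
      · rw [hb', h, flexVec_two] at hb0
        simp [hε.ne_zero] at hb0
    have hinj : ∀ a, (g : PSL(3, ℂ)) • flexPoint ε a = flexPoint ε a → b = a → a = ![0, 2] :=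
      fun a ha hba => flexPoint_injective hε
        (MulAction.injective (g : PSL(3, ℂ)) (ha.trans (hba ▸ hb)))
    have hb2 : b = ![0, 2] := by
      have hb' : b = ![0, b 1] := fin_two_zmod_ext hb' rfl
      rcases zmod_three_cases (b 1) with h | h | h <;> rw [h] at hb'
      · exact hb'.trans (hinj _ h0 hb')
      · exact hb'.trans (hinj _ h1 hb')
      · exact hb'
    intro j
    rcases zmod_three_cases j with rfl | rfl | rfl
    · exact h0
    · exact h1
    · rw [← hb, hb2]
  -- so the second and third coordinates of the images are in the ratio `-ε^j` for each `j`
  obtain ⟨h12, h21', h21⟩ := quadratic_eq_zero hε (p := g.1 1 2) (q := g.1 2 2 - g.1 1 1)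
    (r := -g.1 2 1) fun j => by
      obtain ⟨c, hc⟩ := hmk _ _ (hline j)
      have e1 := congrFun hc 1
      have e2 := congrFun hc 2
      simp [flexVec_zero, Matrix.mulVec, dotProduct, Fin.sum_univ_three] at e1 e2
      linear_combination -e1 - ε ^ j.val * e2
  have h21 : g.1 2 1 = 0 := neg_eq_zero.1 h21
  have h11 : g.1 1 1 = g.1 2 2 := (sub_eq_zero.1 h21').symm
  rw [h01, h02, h12, h21, h11] at hdet
  have hl0 : g.1 2 2 ≠ 0 := by
    intro h
    rw [h] at hdet
    simp at hdet
  have h00 : g.1 0 0 ≠ 0 := by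
    intro h
    rw [h] at hdet
    simp at hdet
  have himg : ∀ j : ZMod 3, g.1 0 0 ^ 3 + g.1 1 0 ^ 3 + (g.1 2 0 - g.1 2 2 * ε ^ j.val) ^ 3 = 0 ∧
      g.1 0 0 * g.1 1 0 * (g.1 2 0 - g.1 2 2 * ε ^ j.val) = 0 := by
    intro j
    have := hzeros ![1, j]
    simpa only [flexVec_one, Matrix.mulVec, dotProduct, Fin.sum_univ_three, Matrix.cons_val_zero,
      Matrix.cons_val_one, Matrix.cons_val, h02, h12, mul_one, mul_zero, zero_mul, add_zero,
      mul_neg, neg_zero, ← sub_eq_add_neg] using this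
  have h10 : g.1 1 0 = 0 := by
    have e0 := (himg 0).2
    have e1 := (himg 1).2
    simp only [ZMod.val_zero, pow_zero, ZMod.val_one, pow_one] at e0 e1
    have : g.1 1 0 * (g.1 0 0 * g.1 2 2 * (ε - 1)) = 0 := by linear_combination e0 - e1
    exact (mul_eq_zero.1 this).resolve_right
      (mul_ne_zero (mul_ne_zero h00 hl0) (sub_ne_zero.2 hε1))
  -- expand the cube in the first equation of `himg`, using that the cube of `ε^j` is `1`
  obtain ⟨hp, -, hr⟩ := quadratic_eq_zero hε (p := g.1 0 0 ^ 3 + g.1 2 0 ^ 3 - g.1 2 2 ^ 3)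
    (q := -3 * g.1 2 0 ^ 2 * g.1 2 2) (r := 3 * g.1 2 0 * g.1 2 2 ^ 2) fun j => by
      have h := (himg j).1
      rw [h10] at h
      linear_combination h + g.1 2 2 ^ 3 * pow_val_pow_three hε j
  have h20 : g.1 2 0 = 0 := by simpa [hl0] using hr
  obtain ⟨k, hk⟩ := exists_eq_pow_of_pow_three_eq_one hε (a := g.1 0 0 / g.1 2 2) (by
    rw [h20] at hp
    field_simp
    linear_combination hp)
  refine ⟨k, g.1 2 2, ?_⟩
  have hk' : g.1 2 2 * ε ^ k.val = g.1 0 0 := by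
    rw [← hk]
    field_simp
  ext i j
  fin_cases i <;> fin_cases j <;> simp [h01, h02, h12, h21, h11, h10, h20, hk']

lemma exists_actsOnLabels (hε : IsPrimitiveRoot ε 3) {g : PSL(3, ℂ)} (hg : g ∈ Hes) :
    ∃ s ∈ SAff (ZMod 3) (Fin 2 → ZMod 3), ActsOnLabels ε g s := by
  obtain ⟨a, ha⟩ := smul_flexPoint_mem_of_mem_Hes hε hg ![0, 0]
  obtain ⟨b, hb⟩ := smul_flexPoint_mem_of_mem_Hes hε hg ![0, 1]
  have hab : a ≠ b := by
    rintro rfl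
    have := flexPoint_injective hε (MulAction.injective g (ha.symm.trans hb))
    revert this
    decide
  obtain ⟨s, ⟨hs, g', hg'⟩, hsa, hsb⟩ := exists_realizable_map_pair hε hab
  obtain ⟨h, hh⟩ := QuotientGroup.mk_surjective (g' * g)
  obtain ⟨k, c, hk⟩ := exists_eq_smul_diagonal hε (g := h)
    (fun x => smul_flexPoint_mem_of_mem_Hes hε (hh ▸ mul_mem (hg'.mem_Hes hε) hg) x)
    (by rw [hh, mul_smul, ← ha, hg', hsa]) (by rw [hh, mul_smul, ← hb, hg', hsb])
  have hact := actsOnLabels_of_matrix (exists_diagonal_mulVec_flexVec hε k) hk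
  rw [hh] at hact
  refine ⟨s⁻¹ * slAffine (shear k), mul_mem (inv_mem hs) (slAffine_mem_SAff _), ?_⟩
  have := hg'.inv.mul hact
  rwa [inv_mul_cancel_left] at this

lemma mem_realizable_of_mem_SAff (hε : IsPrimitiveRoot ε 3)
    {s : (Fin 2 → ZMod 3) ≃ᵃ[ZMod 3] (Fin 2 → ZMod 3)}
    (hs : s ∈ SAff (ZMod 3) (Fin 2 → ZMod 3)) : s ∈ realizable ε := by
  have hab : s ![0, 0] ≠ s ![0, 1] := fun h => by
    have := s.injective h
    revert this
    decide
  obtain ⟨t, ht, ht0, ht1⟩ := exists_realizable_map_pair hε hab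
  obtain ⟨k, hk⟩ := eq_shear_of_mem_SAff (s := t * s) (mul_mem ht.1 hs) ht0 ht1
  rw [← inv_mul_cancel_left t s, hk]
  exact mul_mem (inv_mem ht) (shear_mem_realizable hε k)

lemma eq_one_of_actsOnLabels_one (hε : IsPrimitiveRoot ε 3) {g : PSL(3, ℂ)}
    (hg : ActsOnLabels ε g 1) : g = 1 := by
  induction g using QuotientGroup.induction_on with
  | _ g =>
    obtain ⟨k, c, hk⟩ := exists_eq_smul_diagonal hε (fun a => ⟨_, (hg a).symm⟩) (hg _) (hg _)
    have hshear : slAffine (shear k) = 1 :=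
      (actsOnLabels_of_matrix (exists_diagonal_mulVec_flexVec hε k) hk).unique hε hg
    have hk0 : k = 0 := by
      have h : slAffine (shear k) ![1, 0] = ![1, 0] := by
        rw [hshear]
        rfl
      rw [slAffine_shear] at h
      simpa using congrFun h 1
    have hscalar : Matrix.scalar (Fin 3) c = g.1 := by
      rw [hk, hk0]
      ext i j
      fin_cases i <;> fin_cases j <;> simp
    refine (QuotientGroup.eq_one_iff g).2
      (Matrix.SpecialLinearGroup.mem_center_iff.2 ⟨c, ?_, hscalar⟩)
    rw [← g.2, ← hscalar]
    simp

lemma exists_mulEquiv_SAff (hε : IsPrimitiveRoot ε 3) :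
    ∃ θ : Hes ≃* SAff (ZMod 3) (Fin 2 → ZMod 3), ∀ g : Hes,
      ActsOnLabels ε (g : PSL(3, ℂ)) (θ g : (Fin 2 → ZMod 3) ≃ᵃ[ZMod 3] (Fin 2 → ZMod 3)) := by
  choose s hs hact using fun g : Hes => exists_actsOnLabels hε g.2
  let φ : Hes →* SAff (ZMod 3) (Fin 2 → ZMod 3) :=
    MonoidHom.mk' (fun g => ⟨s g, hs g⟩) fun g h =>
      Subtype.ext ((hact (g * h)).unique hε ((hact g).mul (hact h)))
  have hφ : Function.Bijective φ := by
    constructor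
    · rw [injective_iff_map_eq_one]
      intro g hg
      have h1 : s g = 1 := congrArg Subtype.val hg
      exact Subtype.ext (eq_one_of_actsOnLabels_one hε (h1 ▸ hact g))
    · intro t
      obtain ⟨-, g, hg⟩ := mem_realizable_of_mem_SAff hε t.2
      exact ⟨⟨g, hg.mem_Hes hε⟩, Subtype.ext ((hact _).unique hε hg)⟩
  exact ⟨MulEquiv.ofBijective φ hφ, hact⟩

end

end PlaneCubics

open PlaneCubics in
theorem theorem4 (ε : ℂ) (hε : IsPrimitiveRoot ε 3) :
    -- the line is a relative section
    IsRelativeSection PSL(3, ℂ) hesseLine ∧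
    -- its normalizer is the Hessian group, i.e. the normalizer of the Hesse pencil
    normalizer PSL(3, ℂ) hesseLine = (Hes : Set PSL(3, ℂ)) ∧
    normalizer PSL(3, ℂ) hessePencil = (Hes : Set PSL(3, ℂ)) ∧
    -- the nine labelled points are distinct and are the flexes of every smooth cubic of the pencil
    Function.Injective (flexPoint ε) ∧
    (∀ α β : ℂ, IsSmooth (hesseForm α β : MvPolynomial (Fin 3) ℂ) →
      flexes (hesseForm α β : MvPolynomial (Fin 3) ℂ) = Set.range (flexPoint ε)) ∧
    -- through this labelling, the action on the nine points identifies `Hes` with `SAff`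
    ∃ θ : Hes ≃* SAff (ZMod 3) (Fin 2 → ZMod 3), ∀ (g : Hes) (a : Fin 2 → ZMod 3),
      (g : PSL(3, ℂ)) • flexPoint ε a =
        flexPoint ε ((θ g : (Fin 2 → ZMod 3) ≃ᵃ[ZMod 3] (Fin 2 → ZMod 3)) a) := by
  exact ⟨isRelativeSection_hesseLine, normalizer_hesseLine hε, normalizer_hessePencil hε,
    flexPoint_injective hε, fun α β h => flexes_eq_range hε (discr_ne_zero_of_isSmooth h),
    exists_mulEquiv_SAff hε⟩
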